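/- Consider the measurement model $\mathbf y=\mathbf\Phi\mathbf x+\mathbf n$ with $\mathbf\Phi\in\mathbb R^{M\times N}$ and $\mathbf n\sim\mathcal N(\mathbf 0,\sigma^2\mathbf I)$ independent of the source. The class $C\in\{1,\dots,L\}$ is drawn with probabilities $p_1,\dots,p_L$, and given $C=i$ the source is $\mathbf x\sim\mathcal N(\mathbf 0,\mathbf\Sigma_i)$. The images $\mathcal R_i=\mathrm{Im}(\mathbf\Sigma_i)$ all have the same dimension $r_{\mathbf\Sigma}<N$ and are drawn independently from distributions that have a density with respect to the uniform measure on the Grassmann manifold of $r_{\mathbf\Sigma}$-dimensional subspaces of $\mathbb R^N$. Let $P_e=P_e(\sigma^2,\mathbf\Phi)$ be the misclassification probability of the maximum a posteriori classifier, which knows $p_i,\mathbf\Sigma_i,\mathbf\Phi,\sigma^2$ and chooses $\arg\max_i p_i\,p(\mathbf y\mid C=i)$. Put $R=2\min\{N-r_{\mathbf\Sigma},r_{\mathbf\Sigma}\}$ and let $d_0<R/4$. Consider the integer program $$ \begin{aligned} \underset{(M_1,\ldots,M_L)\in\mathbb N^L}{\text{minimize}}\quad & M=\sum_{i=1}^L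 M_i\\ \text{subject to}\quad & M_i\le N-r_{\mathbf\Sigma}\quad\forall i,\\ & f(M,M_i,M_j)-2(M-2r_{\mathbf\Sigma})>4d_0\quad\forall i\ne j,\\ & f(M,M_i,M_j)-2(M_i-r_{\mathbf\Sigma})>4d_0\quad\forall i\ne j,\\ & f(M,M_i,M_j)-2(M_j-r_{\mathbf\Sigma})>4d_0\quad\forall i\ne j,\\ & f(M,M_i,M_j)>4d_0\quad\forall i\ne j, \end{aligned} $$ where $f(M,M_i,M_j)=\max\{M-r_{\mathbf\Sigma},M_i\}+\max\{M-r_{\mathbf\Sigma},M_j\}$. With probability one over the draw of $\mathcal R_1,\dots,\mathcal R_L$, for all covariance matrices $\mathbf\Sigma_i$ with these images: the program has an optimal value; there is a minimum number $M$ of measurements for which some (designed) matrix $\mathbf\Phi\in\mathbb R^{M\times N}$ satisfies $$\lim_{\sigma^2\to0}-\frac{\log P_e}{\log(1/\sigma^2)}>d_0$$ (the limit existing in $[-\infty,\infty]$, with $\log 0=-\infty$); and this minimum number is at most the optimal value of the program. -/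

import Mathlib

open MeasureTheory ProbabilityTheory Filter Topology
open scoped ENNReal

noncomputable section

namespace LinearClassification

/-! ### Random subspaces -/

/-- The Grassmannian of `r`-dimensional linear subspaces of `ℝᴺ`. -/
def Grassmannian (N r : ℕ) : Type :=
  {V : Submodule ℝ (EuclideanSpace ℝ (Fin N)) // Module.finrank ℝ V = r}

/-- The matrix of the orthogonal projection of `ℝᴺ` onto the subspace `V`. -/
def Grassmannian.proj {N r : ℕ} (V : Grassmannian N r) : Fin N → Fin N → ℝ :=
  fun i j => V.1.starProjection (EuclideanSpace.single j 1) i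

/-- The Borel σ-algebra of the Grassmannian, with a subspace identified with its orthogonal
projection (the usual embedding of the Grassmannian into the space of symmetric matrices). -/
instance (N r : ℕ) : MeasurableSpace (Grassmannian N r) :=
  MeasurableSpace.comap Grassmannian.proj inferInstance

/-- The linear span of `r` linearly independent vectors of `ℝᴺ`. -/
def frameSpan (N r : ℕ)
    (a : {a : Fin r → EuclideanSpace ℝ (Fin N) // LinearIndependent ℝ a}) : Grassmannian N r :=
  ⟨Submodule.span ℝ (Set.range a.1), by simpa using finrank_span_eq_card a.2⟩

/-- The uniform (rotation invariant) probability measure on the Grassmannian, for `r ≤ N`: the law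
of the span of `r` independent standard Gaussian vectors of `ℝᴺ` (which are linearly independent
almost surely). -/
def uniformGrassmann (N r : ℕ) : Measure (Grassmannian N r) :=
  ((Measure.pi fun _ : Fin r => stdGaussian (EuclideanSpace ℝ (Fin N))).comap
    (Subtype.val : {a : Fin r → EuclideanSpace ℝ (Fin N) // LinearIndependent ℝ a} → _)).map
    (frameSpan N r)

/-- The span is a measurable function of the frame, so that the push-forward measure
`uniformGrassmann` is the intended one. -/
theorem measurable_frameSpan (N r : ℕ) : Measurable (frameSpan N r) := by
  refine measurable_comap_iff.2 ?_
  have key : ∀ (a : {a : Fin r → EuclideanSpace ℝ (Fin N) // LinearIndependent ℝ a}) (i j : Fin N),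
      (frameSpan N r a).proj i j =
        ∑ k, (∑ l, (Matrix.gram ℝ a.1).adjugate k l * (a.1 l).ofLp j) /
          (Matrix.gram ℝ a.1).det * (a.1 k).ofLp i := by
    intro a i j
    have hdet : (Matrix.gram ℝ a.1).det ≠ 0 :=
      Matrix.det_gram_ne_zero_iff_linearIndependent.2 a.2
    have h := Submodule.eq_starProjection_of_mem_of_inner_eq_zero
      (K := (frameSpan N r a).1) (u := EuclideanSpace.single j (1 : ℝ))
      (v := ∑ k, ((∑ l, (Matrix.gram ℝ a.1).adjugate k l * (a.1 l).ofLp j) /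
          (Matrix.gram ℝ a.1).det) • a.1 k)
      (Submodule.sum_mem _ fun k _ => Submodule.smul_mem _ _
        (Submodule.subset_span (Set.mem_range_self k))) ?_
    · simp only [Grassmannian.proj]
      rw [h]
      simp
    · intro w hw
      induction hw using Submodule.span_induction with
      | mem x hx =>
        obtain ⟨m, rfl⟩ := hx
        have h2 := congrFun (congrArg (fun A => A.mulVec fun l => (a.1 l).ofLp j)
          (Matrix.mul_adjugate (Matrix.gram ℝ a.1))) m
        rw [← Matrix.mulVec_mulVec, Matrix.smul_mulVec, Matrix.one_mulVec] at h2
        have h3 : ∑ k, ((∑ l, (Matrix.gram ℝ a.1).adjugate k l * (a.1 l).ofLp j) /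
          (Matrix.gram ℝ a.1).det) * inner ℝ (a.1 k) (a.1 m) = (a.1 m).ofLp j := by
          rw [eq_comm, ← mul_right_inj' hdet]
          simp only [Pi.smul_apply, smul_eq_mul] at h2
          rw [← h2, Finset.mul_sum]
          simp only [Matrix.mulVec, dotProduct, Matrix.gram_apply]
          refine Finset.sum_congr rfl fun k _ => ?_
          rw [real_inner_comm (a.1 m)]
          field_simp
        rw [inner_sub_left, sum_inner]
        simp only [inner_smul_left]
        simp only [conj_trivial]
        rw [h3]
        simp [EuclideanSpace.inner_single_left]
      | zero => simp
      | add x y _ _ hx hy => rw [inner_add_right, hx, hy, add_zero]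
      | smul c x _ hx => rw [inner_smul_right, hx, mul_zero]
  refine measurable_pi_lambda _ fun i => measurable_pi_lambda _ fun j => ?_
  simp only [Function.comp_def, key]
  have hv : ∀ k, Continuous
      fun a : {a : Fin r → EuclideanSpace ℝ (Fin N) // LinearIndependent ℝ a} => a.1 k :=
    fun k => (continuous_apply k).comp continuous_subtype_val
  have hc : ∀ k i, Measurable
      fun a : {a : Fin r → EuclideanSpace ℝ (Fin N) // LinearIndependent ℝ a} => (a.1 k).ofLp i :=
    fun k i => ((EuclideanSpace.proj (𝕜 := ℝ) i).continuous.comp (hv k)).measurable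
  have hg : Continuous fun a : {a : Fin r → EuclideanSpace ℝ (Fin N) // LinearIndependent ℝ a} =>
      Matrix.gram ℝ a.1 :=
    continuous_matrix fun k l => (hv k).inner (hv l)
  refine Finset.measurable_fun_sum _ fun k _ => ?_
  refine Measurable.mul (Measurable.div ?_ hg.matrix_det.measurable) (hc k i)
  refine Finset.measurable_fun_sum _ fun l _ => ?_
  exact Measurable.mul (hg.matrix_adjugate.matrix_elem k l).measurable (hc l j)

/-! ### The measurement model, the MAP classifier and its error probability -/

/-- The law of `y = Φ x + n` given a class with covariance matrix `S`: here `x ∼ 𝒩(0, S)` and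
`n ∼ 𝒩(0, v I)` are independent, `v` being the noise variance `σ²`. -/
def measurementLaw {M N : ℕ} (Φ : Matrix (Fin M) (Fin N) ℝ) (S : Matrix (Fin N) (Fin N) ℝ)
    (v : ℝ) : Measure (EuclideanSpace ℝ (Fin M)) :=
  ((multivariateGaussian (0 : EuclideanSpace ℝ (Fin N)) S).prod
    (multivariateGaussian (0 : EuclideanSpace ℝ (Fin M)) (v • 1))).map
    fun q => Φ.toEuclideanLin q.1 + q.2

/-- The density of the centred Gaussian law on `ℝᴹ` with (positive definite) covariance `K`. -/
def gaussianDensity {M : ℕ} (K : Matrix (Fin M) (Fin M) ℝ) (y : EuclideanSpace ℝ (Fin M)) : ℝ :=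
  (Real.sqrt ((2 * Real.pi) ^ M * K.det))⁻¹ *
    Real.exp (-(1 / 2) * (y.ofLp ⬝ᵥ (K⁻¹).mulVec y.ofLp))

/-- The density `p(y | C = i)` of the measurement given a class with covariance matrix `S`. -/
def classDensity {M N : ℕ} (Φ : Matrix (Fin M) (Fin N) ℝ) (S : Matrix (Fin N) (Fin N) ℝ)
    (v : ℝ) (y : EuclideanSpace ℝ (Fin M)) : ℝ :=
  gaussianDensity (Φ * S * Φ.transpose + v • (1 : Matrix (Fin M) (Fin M) ℝ)) y

/-- `c` is a maximum a posteriori classifier: `c y` maximises `p_i p(y | C = i)` over the classes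
`i`, ties being broken in any measurable way. -/
def IsMAP {L M N : ℕ} (p : Fin L → ℝ) (S : Fin L → Matrix (Fin N) (Fin N) ℝ)
    (Φ : Matrix (Fin M) (Fin N) ℝ) (v : ℝ) (c : EuclideanSpace ℝ (Fin M) → Fin L) : Prop :=
  Measurable c ∧ ∀ y i, p i * classDensity Φ (S i) v y ≤ p (c y) * classDensity Φ (S (c y)) v y

/-- A MAP classifier exists as soon as there is a class. -/
theorem exists_isMAP {L M N : ℕ} (hL : 0 < L) (p : Fin L → ℝ)
    (S : Fin L → Matrix (Fin N) (Fin N) ℝ) (Φ : Matrix (Fin M) (Fin N) ℝ) (v : ℝ) :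
    ∃ c, IsMAP p S Φ v c := by
  classical
  have : Nonempty (Fin L) := ⟨⟨0, hL⟩⟩
  set g : Fin L → EuclideanSpace ℝ (Fin M) → ℝ := fun i y => p i * classDensity Φ (S i) v y with hg
  have hgm : ∀ i, Measurable (g i) := fun i => by
    refine Continuous.measurable ?_
    simp only [hg, classDensity, gaussianDensity, Matrix.mulVec, dotProduct]
    fun_prop
  have hex : ∀ y, ∃ i, ∀ j, g j y ≤ g i y := fun y => Finite.exists_max fun i => g i y
  have hne : ∀ y, (Finset.univ.filter fun i => ∀ j, g j y ≤ g i y).Nonempty := fun y => by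
    obtain ⟨i, hi⟩ := hex y
    exact ⟨i, by simpa using hi⟩
  have hset : ∀ i, MeasurableSet {y | ∀ j, g j y ≤ g i y} := fun i => by
    rw [Set.ofPred_forall]
    exact MeasurableSet.iInter fun j => measurableSet_le (hgm j) (hgm i)
  refine ⟨fun y => (Finset.univ.filter fun i => ∀ j, g j y ≤ g i y).min' (hne y), ?_, ?_⟩
  · refine measurable_to_countable' fun i => ?_
    have : (fun y => (Finset.univ.filter fun i => ∀ j, g j y ≤ g i y).min' (hne y)) ⁻¹' {i} =
        {y | ∀ j, g j y ≤ g i y} ∩ ⋂ k : Fin L, ⋂ _ : k < i, {y | ∀ j, g j y ≤ g k y}ᶜ := by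
      ext y
      simp only [Set.mem_preimage, Set.mem_singleton_iff, Set.mem_inter_iff, Set.mem_iInter,
        Finset.min'_eq_iff, Finset.mem_filter, Finset.mem_univ, true_and, Set.mem_compl_iff,
        Set.mem_ofPred_eq]
      refine and_congr_right fun _ => ⟨fun h k hk hh => ?_, fun h k hk => ?_⟩
      · exact absurd (h k hh) (not_le.2 hk)
      · by_contra hlt
        exact h k (not_le.1 hlt) hk
    rw [this]
    exact (hset i).inter (MeasurableSet.iInter fun k => MeasurableSet.iInter fun _ => (hset k).compl)
  · intro y i
    have := Finset.min'_mem _ (hne y)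
    exact (Finset.mem_filter.1 this).2 i

/-- The misclassification probability `∑ᵢ pᵢ ℙ[c(y) ≠ i | C = i]` of the classifier `c`. -/
def errorProb {L M N : ℕ} (p : Fin L → ℝ) (S : Fin L → Matrix (Fin N) (Fin N) ℝ)
    (Φ : Matrix (Fin M) (Fin N) ℝ) (v : ℝ) (c : EuclideanSpace ℝ (Fin M) → Fin L) : ℝ≥0∞ :=
  ∑ i, ENNReal.ofReal (p i) * measurementLaw Φ (S i) v {y | c y ≠ i}

/-- `lim_{σ² → 0} - log P_e / log (1 / σ²) > d₀` for the measurement matrix `Φ`, where `P_e` is the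
misclassification probability of the MAP classifier: the limit exists in the extended reals
(`log 0 = -∞`) and is greater than `d₀`. -/
def DecayExponentGT {L M N : ℕ} (p : Fin L → ℝ) (S : Fin L → Matrix (Fin N) (Fin N) ℝ)
    (Φ : Matrix (Fin M) (Fin N) ℝ) (d₀ : ℝ) : Prop :=
  ∀ c : ℝ → EuclideanSpace ℝ (Fin M) → Fin L, (∀ v, 0 < v → IsMAP p S Φ v (c v)) →
    ∃ l : EReal,
      Tendsto (fun v : ℝ =>
          -(errorProb p S Φ v (c v)).log / ((Real.log (1 / v) : ℝ) : EReal)) (𝓝[>] 0) (𝓝 l) ∧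
        (d₀ : EReal) < l

/-! ### The integer program -/

/-- `f(M, a, b) = max {M - r, a} + max {M - r, b}`. -/
def programF (r M a b : ℤ) : ℤ := max (M - r) a + max (M - r) b

/-- The constraints of the integer program on `(M₁, …, M_L) ∈ ℕᴸ`, with `M = M₁ + ⋯ + M_L`. -/
def IsFeasible (L N r : ℕ) (d₀ : ℝ) (m : Fin L → ℕ) : Prop :=
  (∀ i, (m i : ℤ) ≤ N - r) ∧
    ∀ i j, i ≠ j →
      ((programF r (∑ k, m k : ℕ) (m i) (m j) - 2 * ((∑ k, m k : ℕ) - 2 * r) : ℤ) : ℝ) > 4 * d₀ ∧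
      ((programF r (∑ k, m k : ℕ) (m i) (m j) - 2 * (m i - r) : ℤ) : ℝ) > 4 * d₀ ∧
      ((programF r (∑ k, m k : ℕ) (m i) (m j) - 2 * (m j - r) : ℤ) : ℝ) > 4 * d₀ ∧
      ((programF r (∑ k, m k : ℕ) (m i) (m j) : ℤ) : ℝ) > 4 * d₀

/-- The values of the objective `M = M₁ + ⋯ + M_L` at the feasible points. -/
def programValues (L N r : ℕ) (d₀ : ℝ) : Set ℕ :=
  {M | ∃ m : Fin L → ℕ, IsFeasible L N r d₀ m ∧ M = ∑ i, m i}

end LinearClassification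

end

open LinearClassification

namespace LinearClassification

open scoped Matrix MatrixOrder

/-!
Up to constants the error is the sum over pairs of classes of the overlap `∫ min (g₁ y) (g₂ y) dy`
of their Gaussian densities, whose covariances are `Aᵢ = Φ Σᵢ Φᵀ` plus `v I`. Chernoff's bound
`min a b ≤ a ^ s * b ^ (1 - s)`, with `s` near the better endpoint of `(0, 1)`, bounds the overlap
above. Adding the two quadratic forms in the exponent bounds it below. Both bounds are ratios of
determinants, with orders as `v → 0` arbitrarily close to
`(rank (Aᵢ + Aⱼ) - min (rank Aᵢ) (rank Aⱼ)) / 2`.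

Given a feasible point `m` of the program, let `Φ` have `m l` rows orthogonal to the image of `Σ l`.
This bounds the rank of each `Aᵢ` from above. The rank of `Aᵢ + Aⱼ` is generically as large as
possible: as a function of Gaussian frames of the class subspaces, the relevant Gram determinant is
polynomial, so it vanishes almost nowhere once it is nonzero somewhere, and coordinate subspaces
where it is nonzero are found with Hall's marriage theorem.
-/

/-! ### Gaussian laws -/

theorem map_withDensity_comp {α β : Type*} [MeasurableSpace α] [MeasurableSpace β] {μ : Measure α}
    {f : α → β} {g : β → ℝ≥0∞} (hf : Measurable f) (hg : Measurable g) :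
    (μ.withDensity (g ∘ f)).map f = (μ.map f).withDensity g := by
  ext s hs
  rw [Measure.map_apply hf hs, withDensity_apply _ (hf hs), withDensity_apply _ hs,
    setLIntegral_map hs hg hf]
  rfl

section GaussianDensity

variable {M : ℕ} {K : Matrix (Fin M) (Fin M) ℝ}

theorem continuous_gaussianDensity (K : Matrix (Fin M) (Fin M) ℝ) :
    Continuous (gaussianDensity K) := by
  unfold gaussianDensity Matrix.mulVec dotProduct
  fun_prop

theorem measurable_ofReal_gaussianDensity (K : Matrix (Fin M) (Fin M) ℝ) :
    Measurable fun y => ENNReal.ofReal (gaussianDensity K y) :=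
  (continuous_gaussianDensity K).measurable.ennreal_ofReal

theorem gaussianDensity_nonneg (K : Matrix (Fin M) (Fin M) ℝ) (y : EuclideanSpace ℝ (Fin M)) :
    0 ≤ gaussianDensity K y := by
  unfold gaussianDensity
  positivity

theorem gaussianDensity_pos (hK : 0 < K.det) (y : EuclideanSpace ℝ (Fin M)) :
    0 < gaussianDensity K y := by
  unfold gaussianDensity
  positivity

theorem gaussianDensity_one (y : EuclideanSpace ℝ (Fin M)) :
    gaussianDensity 1 y = (√((2 * Real.pi) ^ M))⁻¹ * Real.exp (-(1 / 2) * ‖y‖ ^ 2) := by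
  rw [EuclideanSpace.real_norm_sq_eq]
  simp [gaussianDensity, dotProduct, sq]

theorem integrable_gaussianDensity_one :
    Integrable (gaussianDensity (1 : Matrix (Fin M) (Fin M) ℝ)) := by
  have h := (GaussianFourier.integrable_cexp_neg_mul_sq_norm_add
    (V := EuclideanSpace ℝ (Fin M)) (b := 1 / 2) (by norm_num) 0 0).norm
  refine (Integrable.const_mul (h.congr (Eventually.of_forall fun y => ?_)) _).congr
    (Eventually.of_forall fun y => (gaussianDensity_one y).symm)
  simp [Complex.norm_exp, ← Complex.ofReal_pow]

theorem integral_gaussianDensity_one_mul_cexp_inner (t : EuclideanSpace ℝ (Fin M)) :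
    ∫ y, (gaussianDensity (1 : Matrix (Fin M) (Fin M) ℝ) y : ℂ) *
      Complex.exp ((inner ℝ y t : ℝ) * Complex.I) = Complex.exp (-‖t‖ ^ 2 / 2) := by
  have hpi : (0 : ℝ) < 2 * Real.pi := by positivity
  have hconst : ((Real.pi : ℂ) / (1 / 2)) ^
      ((Module.finrank ℝ (EuclideanSpace ℝ (Fin M)) : ℂ) / 2) =
      ((√((2 * Real.pi) ^ M) : ℝ) : ℂ) := by
    rw [Real.sqrt_eq_rpow, ← Real.rpow_natCast, ← Real.rpow_mul hpi.le,
      Complex.ofReal_cpow hpi.le]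
    simp only [finrank_euclideanSpace, Fintype.card_fin]
    push_cast
    congr 1 <;> ring
  have hfourier := GaussianFourier.integral_cexp_neg_mul_sq_norm_add
    (V := EuclideanSpace ℝ (Fin M)) (b := 1 / 2) (by norm_num) Complex.I t
  have hintegrand : ∀ y : EuclideanSpace ℝ (Fin M),
      (gaussianDensity (1 : Matrix (Fin M) (Fin M) ℝ) y : ℂ) *
        Complex.exp ((inner ℝ y t : ℝ) * Complex.I) =
      (((√((2 * Real.pi) ^ M))⁻¹ : ℝ) : ℂ) *
        Complex.exp (-(1 / 2) * (‖y‖ : ℂ) ^ 2 + Complex.I * (inner ℝ t y : ℝ)) := by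
    intro y
    rw [gaussianDensity_one, Complex.exp_add, real_inner_comm, mul_comm Complex.I]
    push_cast
    ring
  simp only [hintegrand]
  rw [integral_const_mul, hfourier, hconst, ← mul_assoc, ← Complex.ofReal_mul,
    inv_mul_cancel₀ (by positivity), Complex.ofReal_one, one_mul, Complex.I_sq]
  ring_nf

theorem stdGaussian_eq_withDensity (M : ℕ) :
    stdGaussian (EuclideanSpace ℝ (Fin M)) =
      volume.withDensity fun y => ENNReal.ofReal (gaussianDensity 1 y) := by
  have : IsFiniteMeasure (volume.withDensity fun y : EuclideanSpace ℝ (Fin M) =>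
      ENNReal.ofReal (gaussianDensity 1 y)) :=
    isFiniteMeasure_withDensity_ofReal integrable_gaussianDensity_one.2
  refine Measure.ext_of_charFun (funext fun t => ?_)
  rw [charFun_stdGaussian, charFun_apply, integral_withDensity_eq_integral_toReal_smul
    (measurable_ofReal_gaussianDensity 1) (Eventually.of_forall fun _ => ENNReal.ofReal_lt_top),
    ← integral_gaussianDensity_one_mul_cexp_inner]
  simp only [ENNReal.toReal_ofReal (gaussianDensity_nonneg _ _), Complex.real_smul]

theorem stdGaussian_absolutelyContinuous (M : ℕ) :
    stdGaussian (EuclideanSpace ℝ (Fin M)) ≪ volume := by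
  rw [stdGaussian_eq_withDensity]
  exact withDensity_absolutelyContinuous _ _

theorem gaussianDensity_mul_self_toEuclideanCLM {B : Matrix (Fin M) (Fin M) ℝ}
    (hB : B.IsSymm) (hB0 : B.det ≠ 0) (x : EuclideanSpace ℝ (Fin M)) :
    gaussianDensity (B * B) (Matrix.toEuclideanCLM (𝕜 := ℝ) B x) =
      |B.det|⁻¹ * gaussianDensity 1 x := by
  have hBu : IsUnit B.det := isUnit_iff_ne_zero.2 hB0
  have hcancel : B * (B * B)⁻¹ * B = 1 := by
    rw [Matrix.mul_inv_rev, ← mul_assoc, Matrix.mul_nonsing_inv _ hBu, one_mul,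
      Matrix.nonsing_inv_mul _ hBu]
  have hquad : (B *ᵥ x.ofLp) ⬝ᵥ (B * B)⁻¹ *ᵥ (B *ᵥ x.ofLp) = ‖x‖ ^ 2 := by
    rw [Matrix.mulVec_mulVec, Matrix.dotProduct_mulVec, Matrix.vecMul_mulVec, hB.eq, ← mul_assoc,
      hcancel, Matrix.vecMul_one, EuclideanSpace.real_norm_sq_eq]
    simp [dotProduct, sq]
  rw [gaussianDensity_one, gaussianDensity, Matrix.ofLp_toEuclideanCLM, hquad, Matrix.det_mul,
    Real.sqrt_mul (by positivity), Real.sqrt_mul_self_eq_abs, mul_inv]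
  ring

theorem multivariateGaussian_eq_withDensity (hK : K.PosDef) :
    multivariateGaussian 0 K =
      volume.withDensity fun y => ENNReal.ofReal (gaussianDensity K y) := by
  set B : Matrix (Fin M) (Fin M) ℝ := CFC.sqrt K
  have hBB : B * B = K := CFC.sqrt_mul_sqrt_self K hK.posSemidef.nonneg
  have hBsymm : B.IsSymm := (Matrix.nonneg_iff_posSemidef.1 (CFC.sqrt_nonneg K)).1
  have hB0 : B.det ≠ 0 := fun h => hK.det_pos.ne' (by rw [← hBB, Matrix.det_mul, h, zero_mul])
  set f := Matrix.toEuclideanCLM (𝕜 := ℝ) B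
  have hdet : LinearMap.det (f : EuclideanSpace ℝ (Fin M) →ₗ[ℝ] EuclideanSpace ℝ (Fin M)) =
      B.det := LinearMap.det_toLpLin 2 B
  have hvol : (volume : Measure (EuclideanSpace ℝ (Fin M))).map f =
      ENNReal.ofReal |B.det⁻¹| • volume := by
    rw [← hdet]
    exact Measure.map_linearMap_addHaar_eq_smul_addHaar _ (by rwa [hdet])
  have hpull : (fun y => ENNReal.ofReal (gaussianDensity 1 y)) =
      ENNReal.ofReal |B.det| • ((fun y => ENNReal.ofReal (gaussianDensity K y)) ∘ f) := by
    ext x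
    simp only [Pi.smul_apply, Function.comp_apply, smul_eq_mul]
    rw [← ENNReal.ofReal_mul (abs_nonneg _), ← hBB,
      gaussianDensity_mul_self_toEuclideanCLM hBsymm hB0,
      mul_inv_cancel_left₀ (abs_ne_zero.2 hB0)]
  have hscale : ENNReal.ofReal |B.det| * ENNReal.ofReal |B.det⁻¹| = 1 := by
    rw [← ENNReal.ofReal_mul (abs_nonneg _), abs_inv, mul_inv_cancel₀ (abs_ne_zero.2 hB0),
      ENNReal.ofReal_one]
  simp only [multivariateGaussian, zero_add]
  rw [stdGaussian_eq_withDensity, hpull, withDensity_smul' _ _ ENNReal.ofReal_ne_top,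
    Measure.map_smul, map_withDensity_comp (by fun_prop) (measurable_ofReal_gaussianDensity K),
    hvol, withDensity_smul_measure, smul_smul, hscale, one_smul]

theorem lintegral_gaussianDensity (hK : K.PosDef) :
    ∫⁻ y, ENNReal.ofReal (gaussianDensity K y) = 1 := by
  have h := measure_univ (μ := multivariateGaussian 0 K)
  rwa [multivariateGaussian_eq_withDensity hK, withDensity_apply _ MeasurableSet.univ,
    setLIntegral_univ] at h

theorem lintegral_exp_neg_half_dotProduct_mulVec {Q : Matrix (Fin M) (Fin M) ℝ} (hQ : Q.PosDef) :
    ∫⁻ y : EuclideanSpace ℝ (Fin M),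
        ENNReal.ofReal (Real.exp (-(1 / 2) * (y.ofLp ⬝ᵥ Q *ᵥ y.ofLp))) =
      ENNReal.ofReal √((2 * Real.pi) ^ M / Q.det) := by
  have hdet : 0 < Q.det := hQ.det_pos
  have hpos : 0 < √((2 * Real.pi) ^ M / Q.det) := by positivity
  have h := lintegral_gaussianDensity hQ.inv
  simp only [gaussianDensity, Matrix.nonsing_inv_nonsing_inv _ (isUnit_iff_ne_zero.2 hdet.ne'),
    Matrix.det_nonsing_inv, Ring.inverse_eq_inv', ← div_eq_mul_inv,
    ENNReal.ofReal_mul (inv_nonneg.2 hpos.le)] at h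
  rwa [lintegral_const_mul' _ _ ENNReal.ofReal_ne_top, ENNReal.ofReal_inv_of_pos hpos, mul_comm,
    ← div_eq_mul_inv, ENNReal.div_eq_one_iff (by simpa using hpos) ENNReal.ofReal_ne_top] at h

end GaussianDensity

section MeasurementLaw

theorem map_toEuclideanLin_multivariateGaussian {m n : Type*} [Fintype m] [DecidableEq m]
    [Fintype n] [DecidableEq n] (Φ : Matrix m n ℝ) {S : Matrix n n ℝ} (hS : S.PosSemidef) :
    (multivariateGaussian 0 S).map Φ.toEuclideanLin = multivariateGaussian 0 (Φ * S * Φᵀ) := by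
  have hcont : Continuous Φ.toEuclideanLin := LinearMap.continuous_of_finiteDimensional _
  have : IsProbabilityMeasure ((multivariateGaussian 0 S).map Φ.toEuclideanLin) :=
    Measure.isProbabilityMeasure_map hcont.aemeasurable
  have hcov : (Φ * S * Φᵀ).PosSemidef := by simpa using hS.mul_mul_conjTranspose_same Φ
  have hadj : ∀ x t, inner ℝ (Φ.toEuclideanLin x) t = inner ℝ x (Φᵀ.toEuclideanLin t) := by
    intro x t
    rw [← Matrix.conjTranspose_eq_transpose_of_trivial,
      Matrix.toEuclideanLin_conjTranspose_eq_adjoint, LinearMap.adjoint_inner_right]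
  refine Measure.ext_of_charFun (funext fun t => ?_)
  rw [charFun_apply, integral_map hcont.aemeasurable (by fun_prop)]
  simp only [hadj]
  rw [← charFun_apply, charFun_multivariateGaussian hS, charFun_multivariateGaussian hcov]
  simp only [inner_zero_right, Matrix.toLpLin_apply, ← Matrix.mulVec_mulVec,
    Matrix.dotProduct_mulVec t.ofLp Φ, Matrix.mulVec_transpose]

theorem multivariateGaussian_conv {n : Type*} [Fintype n] [DecidableEq n] {S T : Matrix n n ℝ}
    (hS : S.PosSemidef) (hT : T.PosSemidef) :
    multivariateGaussian 0 S ∗ multivariateGaussian 0 T = multivariateGaussian 0 (S + T) := by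
  refine Measure.ext_of_charFun (funext fun t => ?_)
  rw [charFun_conv, charFun_multivariateGaussian hS, charFun_multivariateGaussian hT,
    charFun_multivariateGaussian (hS.add hT), ← Complex.exp_add, Matrix.add_mulVec, dotProduct_add]
  simp only [inner_zero_right]
  push_cast
  ring_nf

theorem posDef_add_smul_one {n : Type*} [DecidableEq n] {A : Matrix n n ℝ} (hA : A.PosSemidef)
    {v : ℝ} (hv : 0 < v) : (A + v • (1 : Matrix n n ℝ)).PosDef :=
  Matrix.PosDef.posSemidef_add hA (Matrix.PosDef.one.smul hv)

variable {M N : ℕ} (Φ : Matrix (Fin M) (Fin N) ℝ) {S : Matrix (Fin N) (Fin N) ℝ} {v : ℝ}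

theorem measurementLaw_eq_multivariateGaussian (hS : S.PosSemidef) (hv : 0 < v) :
    measurementLaw Φ S v = multivariateGaussian 0 (Φ * S * Φᵀ + v • 1) := by
  have hmeas : Measurable Φ.toEuclideanLin :=
    (LinearMap.continuous_of_finiteDimensional _).measurable
  have hcov : (Φ * S * Φᵀ).PosSemidef := by simpa using hS.mul_mul_conjTranspose_same Φ
  have hcomp : (fun q : EuclideanSpace ℝ (Fin N) × EuclideanSpace ℝ (Fin M) =>
      Φ.toEuclideanLin q.1 + q.2) = (fun q => q.1 + q.2) ∘ Prod.map Φ.toEuclideanLin id := rfl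
  rw [measurementLaw, hcomp, ← Measure.map_map (by fun_prop) (by fun_prop),
    ← Measure.map_prod_map _ _ hmeas measurable_id, Measure.map_id,
    map_toEuclideanLin_multivariateGaussian Φ hS, ← Measure.conv,
    multivariateGaussian_conv hcov (Matrix.PosDef.one.smul hv).posSemidef]

theorem ofReal_mul_measurementLaw_apply (hS : S.PosSemidef) (hv : 0 < v) {a : ℝ} (ha : 0 ≤ a)
    {s : Set (EuclideanSpace ℝ (Fin M))} (hs : MeasurableSet s) :
    ENNReal.ofReal a * measurementLaw Φ S v s =
      ∫⁻ y in s, ENNReal.ofReal (a * classDensity Φ S v y) := by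
  have hcov : (Φ * S * Φᵀ).PosSemidef := by simpa using hS.mul_mul_conjTranspose_same Φ
  rw [measurementLaw_eq_multivariateGaussian Φ hS hv,
    multivariateGaussian_eq_withDensity (posDef_add_smul_one hcov hv), withDensity_apply _ hs,
    ← lintegral_const_mul' _ _ ENNReal.ofReal_ne_top]
  simp only [← ENNReal.ofReal_mul ha]
  rfl

end MeasurementLaw

/-! ### Ranks and determinants of positive semidefinite matrices -/

section PosSemidef

variable {n : Type*} [Fintype n] {A B : Matrix n n ℝ}

theorem mulVec_eq_zero_of_add_mulVec_eq_zero (hA : A.PosSemidef) (hB : B.PosSemidef) {x : n → ℝ}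
    (hx : (A + B) *ᵥ x = 0) : A *ᵥ x = 0 := by
  refine (hA.dotProduct_mulVec_zero_iff x).1 ?_
  have hA0 := hA.dotProduct_mulVec_nonneg x
  have hB0 := hB.dotProduct_mulVec_nonneg x
  have hsum : star x ⬝ᵥ A *ᵥ x + star x ⬝ᵥ B *ᵥ x = 0 := by
    rw [← dotProduct_add, ← Matrix.add_mulVec, hx, dotProduct_zero]
  linarith

variable [DecidableEq n]

theorem rank_eq_finrank_range_toEuclideanLin (A : Matrix n n ℝ) :
    A.rank = Module.finrank ℝ (LinearMap.range A.toEuclideanLin) := by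
  rw [A.rank_eq_finrank_range_toLin (PiLp.basisFun 2 ℝ n) (PiLp.basisFun 2 ℝ n),
    ← Matrix.toLpLin_eq_toLin]

theorem range_toEuclideanLin_le_range_add (hA : A.PosSemidef) (hB : B.PosSemidef) :
    LinearMap.range A.toEuclideanLin ≤ LinearMap.range (A + B).toEuclideanLin := by
  have hA' := (Matrix.isPositive_toEuclideanLin_iff.2 hA).1
  have hAB' := (Matrix.isPositive_toEuclideanLin_iff.2 (hA.add hB)).1
  rw [← Submodule.orthogonal_orthogonal (LinearMap.range A.toEuclideanLin),
    ← Submodule.orthogonal_orthogonal (LinearMap.range (A + B).toEuclideanLin),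
    hA'.orthogonal_range, hAB'.orthogonal_range]
  refine Submodule.orthogonal_le fun x hx => LinearMap.mem_ker.2 (congrArg (WithLp.toLp 2) ?_)
  exact mulVec_eq_zero_of_add_mulVec_eq_zero hA hB (congrArg WithLp.ofLp (LinearMap.mem_ker.1 hx))

theorem range_toEuclideanLin_add (hA : A.PosSemidef) (hB : B.PosSemidef) :
    LinearMap.range (A + B).toEuclideanLin =
      LinearMap.range A.toEuclideanLin ⊔ LinearMap.range B.toEuclideanLin := by
  refine le_antisymm ?_ (sup_le (range_toEuclideanLin_le_range_add hA hB) ?_)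
  · rw [map_add]
    exact LinearMap.range_add_le _ _
  · rw [add_comm]
    exact range_toEuclideanLin_le_range_add hB hA

theorem rank_smul_add_smul {n : Type*} [Fintype n] {A B : Matrix n n ℝ} (hA : A.PosSemidef)
    (hB : B.PosSemidef) {s t : ℝ} (hs : 0 < s) (ht : 0 < t) :
    (s • A + t • B).rank = (A + B).rank := by
  classical
  rw [rank_eq_finrank_range_toEuclideanLin, rank_eq_finrank_range_toEuclideanLin,
    range_toEuclideanLin_add (hA.smul hs.le) (hB.smul ht.le), range_toEuclideanLin_add hA hB,
    map_smul, map_smul, LinearMap.range_smul _ _ hs.ne', LinearMap.range_smul _ _ ht.ne']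

theorem det_add_smul_one (hA : A.IsHermitian) (v : ℝ) :
    (A + v • (1 : Matrix n n ℝ)).det = ∏ i, (hA.eigenvalues i + v) := by
  have hneg : Matrix.scalar n (-v) - A = -(A + v • (1 : Matrix n n ℝ)) := by
    rw [Matrix.scalar_apply, ← Matrix.smul_one_eq_diagonal, neg_smul]
    abel
  have hchar := Matrix.eval_charpoly A (-v)
  rw [hA.charpoly_eq, Polynomial.eval_prod, hneg, Matrix.det_neg, ← Finset.card_univ,
    ← Finset.prod_const] at hchar
  refine mul_left_cancel₀ (Finset.prod_ne_zero_iff.2 fun _ _ => neg_ne_zero.2 one_ne_zero)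
    (hchar.symm.trans ?_)
  rw [← Finset.prod_mul_distrib]
  refine Finset.prod_congr rfl fun i _ => ?_
  simp only [Polynomial.eval_sub, Polynomial.eval_X, Polynomial.eval_C, RCLike.ofReal_real_eq_id,
    id_eq]
  ring

theorem det_smul_inv_add_smul_inv (hA : IsUnit A.det) (hB : IsUnit B.det) (s t : ℝ) :
    (s • A⁻¹ + t • B⁻¹).det = (t • A + s • B).det / (A.det * B.det) := by
  have hmul : A * (s • A⁻¹ + t • B⁻¹) * B = t • A + s • B := by
    rw [mul_add, Matrix.mul_smul, Matrix.mul_smul, Matrix.mul_nonsing_inv _ hA, add_mul,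
      Matrix.smul_mul, Matrix.smul_mul, one_mul, mul_assoc, Matrix.nonsing_inv_mul _ hB, mul_one,
      add_comm]
  rw [← hmul, Matrix.det_mul, Matrix.det_mul, eq_div_iff (mul_ne_zero hA.ne_zero hB.ne_zero)]
  ring

end PosSemidef

/-! ### Orders of vanishing at zero -/

/-- `f` is positive near `0⁺` and of order `v ^ e` there on the logarithmic scale, that is,
`log f(v) / log v → e` as `v → 0⁺`. -/
def HasOrder (f : ℝ → ℝ) (e : ℝ) : Prop :=
  (∀ᶠ v in 𝓝[>] 0, 0 < f v) ∧ Tendsto (fun v => Real.log (f v) / Real.log v) (𝓝[>] 0) (𝓝 e)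

namespace HasOrder

variable {f g : ℝ → ℝ} {a b d : ℝ}

theorem of_tendsto (hf : Tendsto f (𝓝[>] 0) (𝓝 a)) (ha : 0 < a) : HasOrder f 0 :=
  ⟨hf.eventually (lt_mem_nhds ha),
    (hf.log ha.ne').div_atBot Real.tendsto_log_nhdsGT_zero⟩

theorem id : HasOrder (fun v => v) 1 := by
  refine ⟨self_mem_nhdsWithin, tendsto_const_nhds.congr' ?_⟩
  filter_upwards [Ioo_mem_nhdsGT one_pos] with v hv
  exact (div_self (Real.log_neg hv.1 hv.2).ne).symm

theorem mul (hf : HasOrder f a) (hg : HasOrder g b) : HasOrder (fun v => f v * g v) (a + b) := by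
  refine ⟨(hf.1.and hg.1).mono fun v h => mul_pos h.1 h.2, (hf.2.add hg.2).congr' ?_⟩
  filter_upwards [hf.1, hg.1] with v hfv hgv
  rw [Real.log_mul hfv.ne' hgv.ne', add_div]

theorem rpow (hf : HasOrder f a) (t : ℝ) : HasOrder (fun v => f v ^ t) (t * a) := by
  refine ⟨hf.1.mono fun v h => Real.rpow_pos_of_pos h t, (hf.2.const_mul t).congr' ?_⟩
  filter_upwards [hf.1] with v hfv
  rw [Real.log_rpow hfv, mul_div_assoc]

theorem div (hf : HasOrder f a) (hg : HasOrder g b) : HasOrder (fun v => f v / g v) (a - b) := by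
  refine ⟨(hf.1.and hg.1).mono fun v h => div_pos h.1 h.2, (hf.2.sub hg.2).congr' ?_⟩
  filter_upwards [hf.1, hg.1] with v hfv hgv
  rw [Real.log_div hfv.ne' hgv.ne', sub_div]

theorem sqrt (hf : HasOrder f a) : HasOrder (fun v => √(f v)) (a / 2) := by
  simpa only [Real.sqrt_eq_rpow, one_div, inv_mul_eq_div] using hf.rpow (1 / 2)

theorem min (hf : HasOrder f a) (hg : HasOrder g b) :
    HasOrder (fun v => min (f v) (g v)) (max a b) := by
  refine ⟨(hf.1.and hg.1).mono fun v h => lt_min h.1 h.2, (hf.2.max hg.2).congr' ?_⟩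
  filter_upwards [hf.1, hg.1, Ioo_mem_nhdsGT one_pos] with v hfv hgv hv
  have hlog : Real.log v ≤ 0 := (Real.log_neg hv.1 hv.2).le
  rcases le_total (f v) (g v) with h | h
  · rw [min_eq_left h, max_eq_left (div_le_div_of_nonpos_of_le hlog (Real.log_le_log hfv h))]
  · rw [min_eq_right h, max_eq_right (div_le_div_of_nonpos_of_le hlog (Real.log_le_log hgv h))]

theorem prod {ι : Type*} {F : ι → ℝ → ℝ} {e : ι → ℝ} (s : Finset ι)
    (h : ∀ i ∈ s, HasOrder (F i) (e i)) :
    HasOrder (fun v => ∏ i ∈ s, F i v) (∑ i ∈ s, e i) := by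
  classical
  induction s using Finset.induction_on with
  | empty =>
    simpa only [Finset.prod_empty, Finset.sum_empty] using of_tendsto tendsto_const_nhds one_pos
  | insert i s hi ih =>
    simp only [Finset.prod_insert hi, Finset.sum_insert hi]
    exact (h i (Finset.mem_insert_self i s)).mul
      (ih fun j hj => h j (Finset.mem_insert_of_mem hj))

theorem eventually_le_rpow (hf : HasOrder f a) (hd : d < a) : ∀ᶠ v in 𝓝[>] 0, f v ≤ v ^ d := by
  filter_upwards [hf.1, hf.2.eventually (lt_mem_nhds hd), Ioo_mem_nhdsGT one_pos]
    with v hfv hlt hv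
  rw [← Real.log_le_log_iff hfv (Real.rpow_pos_of_pos hv.1 d), Real.log_rpow hv.1]
  exact ((lt_div_iff_of_neg (Real.log_neg hv.1 hv.2)).1 hlt).le

theorem eventually_rpow_le (hf : HasOrder f a) (hd : a < d) : ∀ᶠ v in 𝓝[>] 0, v ^ d ≤ f v := by
  filter_upwards [hf.1, hf.2.eventually (gt_mem_nhds hd), Ioo_mem_nhdsGT one_pos]
    with v hfv hlt hv
  rw [← Real.log_le_log_iff (Real.rpow_pos_of_pos hv.1 d) hfv, Real.log_rpow hv.1]
  exact ((div_lt_iff_of_neg (Real.log_neg hv.1 hv.2)).1 hlt).le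

end HasOrder

theorem hasOrder_det_add_mul_smul_one {n : Type*} [Fintype n] [DecidableEq n] {A : Matrix n n ℝ}
    (hA : A.PosSemidef) {t : ℝ} (ht : 0 < t) :
    HasOrder (fun v => (A + (t * v) • (1 : Matrix n n ℝ)).det)
      ((Fintype.card n : ℝ) - A.rank) := by
  have hcard : (Fintype.card n : ℝ) - A.rank = ∑ i, if hA.1.eigenvalues i = 0 then 1 else 0 := by
    rw [hA.1.rank_eq_card_non_zero_eigs, Fintype.card_subtype, Finset.sum_boole, sub_eq_iff_eq_add,
      ← Finset.card_univ]
    exact_mod_cast (Finset.card_filter_add_card_filter_not _).symm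
  have htend : Tendsto (fun v : ℝ => t * v) (𝓝[>] 0) (𝓝 0) := by
    simpa using (tendsto_nhdsWithin_of_tendsto_nhds (tendsto_id (x := 𝓝 (0 : ℝ)))).const_mul t
  simp only [det_add_smul_one hA.1, hcard]
  refine HasOrder.prod _ fun i _ => ?_
  split_ifs with hi
  · simpa only [hi, zero_add] using (HasOrder.of_tendsto tendsto_const_nhds ht).mul HasOrder.id
  · refine HasOrder.of_tendsto (by simpa using htend.const_add (hA.1.eigenvalues i)) ?_
    exact (hA.eigenvalues_nonneg i).lt_of_ne' hi

section Decay

variable {F G : ℝ → ℝ≥0∞} {e : EReal}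

/-- `F v` is `O(v ^ d)` as `v → 0⁺` for every real `d < e`: the decay exponent of `F` is at least
`e`. For `e = ⊤` this is decay faster than any power. -/
def DecaysAtLeast (F : ℝ → ℝ≥0∞) (e : EReal) : Prop :=
  ∀ d : ℝ, (d : EReal) < e → ∀ᶠ v in 𝓝[>] 0, F v ≤ ENNReal.ofReal (v ^ d)

/-- `v ^ d` is `O(F v)` as `v → 0⁺` for every real `d > e`: the decay exponent of `F` is at most
`e`. -/
def DecaysAtMost (F : ℝ → ℝ≥0∞) (e : EReal) : Prop :=
  ∀ d : ℝ, e < (d : EReal) → ∀ᶠ v in 𝓝[>] 0, ENNReal.ofReal (v ^ d) ≤ F v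

theorem HasOrder.decaysAtMost {f : ℝ → ℝ} {a : ℝ} (hf : HasOrder f a) :
    DecaysAtMost (fun v => ENNReal.ofReal (f v)) a := fun _ hd =>
  (hf.eventually_rpow_le (EReal.coe_lt_coe_iff.1 hd)).mono fun _ => ENNReal.ofReal_le_ofReal

theorem eventually_mul_ofReal_rpow_le {C : ℝ≥0∞} (hC : C ≠ ∞) {d d' : ℝ} (hd : d < d') :
    ∀ᶠ v : ℝ in 𝓝[>] 0, C * ENNReal.ofReal (v ^ d') ≤ ENNReal.ofReal (v ^ d) := by
  have htend : Tendsto (fun v : ℝ => C.toReal * v ^ (d' - d)) (𝓝[>] 0) (𝓝 0) := by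
    have h := (Real.continuousAt_rpow_const 0 (d' - d) (Or.inr (sub_pos.2 hd).le)).tendsto
    rw [Real.zero_rpow (sub_pos.2 hd).ne'] at h
    simpa using (tendsto_nhdsWithin_of_tendsto_nhds h).const_mul C.toReal
  filter_upwards [htend.eventually (gt_mem_nhds one_pos), self_mem_nhdsWithin] with v hlt hv
  rw [← ENNReal.ofReal_toReal hC, ← ENNReal.ofReal_mul ENNReal.toReal_nonneg]
  refine ENNReal.ofReal_le_ofReal ?_
  calc C.toReal * v ^ d' = C.toReal * v ^ (d' - d) * v ^ d := by
        rw [mul_assoc, ← Real.rpow_add hv, sub_add_cancel]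
    _ ≤ v ^ d := mul_le_of_le_one_left (Real.rpow_nonneg hv.le d) hlt.le

theorem DecaysAtLeast.mono (hG : DecaysAtLeast G e) (h : ∀ᶠ v in 𝓝[>] 0, F v ≤ G v) :
    DecaysAtLeast F e := fun d hd => by
  filter_upwards [hG d hd, h] with v hGv hv using hv.trans hGv

theorem DecaysAtLeast.anti {e' : EReal} (hF : DecaysAtLeast F e) (h : e' ≤ e) :
    DecaysAtLeast F e' := fun d hd => hF d (hd.trans_le h)

theorem DecaysAtMost.mono (hF : DecaysAtMost F e) (h : ∀ᶠ v in 𝓝[>] 0, F v ≤ G v) :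
    DecaysAtMost G e := fun d hd => by
  filter_upwards [hF d hd, h] with v hFv hv using hFv.trans hv

theorem DecaysAtLeast.const_mul (hF : DecaysAtLeast F e) {C : ℝ≥0∞} (hC : C ≠ ∞) :
    DecaysAtLeast (fun v => C * F v) e := fun d hd => by
  obtain ⟨d', hdd', hd'⟩ := EReal.lt_iff_exists_real_btwn.1 hd
  filter_upwards [hF d' hd', eventually_mul_ofReal_rpow_le hC (EReal.coe_lt_coe_iff.1 hdd')]
    with v hFv hv
  exact (mul_le_mul_right hFv C).trans hv

theorem DecaysAtMost.const_mul (hF : DecaysAtMost F e) {C : ℝ≥0∞} (hC0 : C ≠ 0) (hC : C ≠ ∞) :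
    DecaysAtMost (fun v => C * F v) e := fun d hd => by
  obtain ⟨d', hd', hdd'⟩ := EReal.lt_iff_exists_real_btwn.1 hd
  filter_upwards [hF d' hd', eventually_mul_ofReal_rpow_le (ENNReal.inv_ne_top.2 hC0)
    (EReal.coe_lt_coe_iff.1 hdd')] with v hFv hv
  exact ((ENNReal.inv_mul_le_iff hC0 hC).1 hv).trans (mul_le_mul_right hFv C)

theorem DecaysAtLeast.sum {ι : Type*} {F : ι → ℝ → ℝ≥0∞} {s : Finset ι}
    (h : ∀ i ∈ s, DecaysAtLeast (F i) e) : DecaysAtLeast (fun v => ∑ i ∈ s, F i v) e :=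
  fun d hd => by
  obtain ⟨d', hdd', hd'⟩ := EReal.lt_iff_exists_real_btwn.1 hd
  filter_upwards [(Finset.eventually_all s).2 fun i hi => h i hi d' hd',
    eventually_mul_ofReal_rpow_le (ENNReal.natCast_ne_top s.card) (EReal.coe_lt_coe_iff.1 hdd')]
    with v hFv hv
  calc ∑ i ∈ s, F i v ≤ s.card • ENNReal.ofReal (v ^ d') := Finset.sum_le_card_nsmul s _ _ hFv
    _ ≤ ENNReal.ofReal (v ^ d) := by rwa [nsmul_eq_mul]

theorem neg_log_ofReal_rpow_div {v : ℝ} (hv : v ∈ Set.Ioo 0 1) (d : ℝ) :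
    -(ENNReal.ofReal (v ^ d)).log / ((Real.log (1 / v) : ℝ) : EReal) = d := by
  rw [ENNReal.log_ofReal_of_pos (Real.rpow_pos_of_pos hv.1 d), ← EReal.coe_neg, ← EReal.coe_div,
    Real.log_rpow hv.1, one_div, Real.log_inv, ← mul_neg,
    mul_div_cancel_right₀ d (neg_ne_zero.2 (Real.log_neg hv.1 hv.2).ne)]

theorem neg_log_div_log_le {v : ℝ} (hv : v ∈ Set.Ioo 0 1) {x y : ℝ≥0∞} (hxy : x ≤ y) :
    -y.log / ((Real.log (1 / v) : ℝ) : EReal) ≤ -x.log / ((Real.log (1 / v) : ℝ) : EReal) := by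
  refine EReal.div_le_div_right_of_nonneg (EReal.coe_nonneg.2 ?_)
    (EReal.neg_le_neg_iff.2 (ENNReal.log_monotone hxy))
  exact Real.log_nonneg ((one_le_div hv.1).2 hv.2.le)

theorem tendsto_neg_log_div_log (hF : DecaysAtLeast F e) (hF' : DecaysAtMost F e) :
    Tendsto (fun v : ℝ => -(F v).log / ((Real.log (1 / v) : ℝ) : EReal)) (𝓝[>] 0) (𝓝 e) := by
  refine tendsto_order.2 ⟨fun a ha => ?_, fun a ha => ?_⟩
  · obtain ⟨d, had, hde⟩ := EReal.lt_iff_exists_real_btwn.1 ha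
    filter_upwards [hF d hde, Ioo_mem_nhdsGT one_pos] with v hFv hv
    exact had.trans_le ((neg_log_ofReal_rpow_div hv d).ge.trans (neg_log_div_log_le hv hFv))
  · obtain ⟨d, hed, hda⟩ := EReal.lt_iff_exists_real_btwn.1 ha
    filter_upwards [hF' d hed, Ioo_mem_nhdsGT one_pos] with v hFv hv
    exact ((neg_log_div_log_le hv hFv).trans (neg_log_ofReal_rpow_div hv d).le).trans_lt hda

end Decay

/-! ### The overlap of two Gaussian densities -/

section Overlap

variable {M : ℕ} {K₁ K₂ : Matrix (Fin M) (Fin M) ℝ}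

/-- The overlap `∫ min (g₁ y) (g₂ y) dy` of the centred Gaussian densities `g₁` and `g₂` with
covariances `K₁` and `K₂`; up to constants it is the error of the best test between them. -/
noncomputable def overlap (K₁ K₂ : Matrix (Fin M) (Fin M) ℝ) : ℝ≥0∞ :=
  ∫⁻ y, ENNReal.ofReal (min (gaussianDensity K₁ y) (gaussianDensity K₂ y))

theorem sqrt_inv_mul_sqrt_div {P a b D : ℝ} (hP : 0 < P) (ha : 0 < a) (hb : 0 < b) :
    (√(P * b))⁻¹ * √(P / (D / (a * b))) = √(a / D) := by
  rw [← Real.sqrt_inv, ← Real.sqrt_mul (by positivity)]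
  congr 1
  field_simp

theorem le_overlap (h₁ : K₁.PosDef) (h₂ : K₂.PosDef) :
    ENNReal.ofReal (min √(K₁.det / (K₁ + K₂).det) √(K₂.det / (K₁ + K₂).det)) ≤
      overlap K₁ K₂ := by
  have d₁ := h₁.det_pos
  have d₂ := h₂.det_pos
  set P : ℝ := (2 * Real.pi) ^ M
  have hP : 0 < P := by positivity
  set m := min (√(P * K₁.det))⁻¹ (√(P * K₂.det))⁻¹
  have hm : 0 ≤ m := le_min (by positivity) (by positivity)
  have hpointwise (y : EuclideanSpace ℝ (Fin M)) :
      m * Real.exp (-(1 / 2) * (y.ofLp ⬝ᵥ (K₁⁻¹ + K₂⁻¹) *ᵥ y.ofLp)) ≤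
        min (gaussianDensity K₁ y) (gaussianDensity K₂ y) := by
    have q₁ : 0 ≤ y.ofLp ⬝ᵥ K₁⁻¹ *ᵥ y.ofLp := h₁.inv.posSemidef.dotProduct_mulVec_nonneg y.ofLp
    have q₂ : 0 ≤ y.ofLp ⬝ᵥ K₂⁻¹ *ᵥ y.ofLp := h₂.inv.posSemidef.dotProduct_mulVec_nonneg y.ofLp
    rw [Matrix.add_mulVec, dotProduct_add]
    refine le_min (mul_le_mul (min_le_left _ _) ?_ (Real.exp_pos _).le (by positivity))
      (mul_le_mul (min_le_right _ _) ?_ (Real.exp_pos _).le (by positivity)) <;>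
    exact Real.exp_le_exp.2 (by linarith)
  have hdet : (K₁⁻¹ + K₂⁻¹).det = (K₁ + K₂).det / (K₁.det * K₂.det) := by
    simpa only [one_smul] using
      det_smul_inv_add_smul_inv (isUnit_iff_ne_zero.2 d₁.ne') (isUnit_iff_ne_zero.2 d₂.ne') 1 1
  calc ENNReal.ofReal (min √(K₁.det / (K₁ + K₂).det) √(K₂.det / (K₁ + K₂).det))
      = ENNReal.ofReal (m * √(P / (K₁⁻¹ + K₂⁻¹).det)) := by
        rw [hdet, min_mul_of_nonneg _ _ (Real.sqrt_nonneg _), sqrt_inv_mul_sqrt_div hP d₁ d₂,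
          mul_comm K₁.det K₂.det, sqrt_inv_mul_sqrt_div hP d₂ d₁, min_comm]
    _ = ∫⁻ y : EuclideanSpace ℝ (Fin M), ENNReal.ofReal
          (m * Real.exp (-(1 / 2) * (y.ofLp ⬝ᵥ (K₁⁻¹ + K₂⁻¹) *ᵥ y.ofLp))) := by
        simp only [ENNReal.ofReal_mul hm]
        rw [lintegral_const_mul' _ _ ENNReal.ofReal_ne_top,
          lintegral_exp_neg_half_dotProduct_mulVec (h₁.inv.add h₂.inv)]
    _ ≤ overlap K₁ K₂ := lintegral_mono fun y => ENNReal.ofReal_le_ofReal (hpointwise y)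

theorem min_le_rpow_mul_rpow {a b s : ℝ} (ha : 0 < a) (hb : 0 < b) (hs : s ∈ Set.Icc 0 1) :
    min a b ≤ a ^ s * b ^ (1 - s) := by
  have h : 0 < min a b := lt_min ha hb
  calc min a b = min a b ^ s * min a b ^ (1 - s) := by
        rw [← Real.rpow_add h, add_sub_cancel, Real.rpow_one]
    _ ≤ a ^ s * b ^ (1 - s) :=
        mul_le_mul (Real.rpow_le_rpow h.le (min_le_left _ _) hs.1)
          (Real.rpow_le_rpow h.le (min_le_right _ _) (sub_nonneg.2 hs.2)) (by positivity)
          (by positivity)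

theorem gaussianDensity_rpow_mul_rpow (h₁ : 0 < K₁.det) (h₂ : 0 < K₂.det) (s : ℝ)
    (y : EuclideanSpace ℝ (Fin M)) :
    gaussianDensity K₁ y ^ s * gaussianDensity K₂ y ^ (1 - s) =
      (√((2 * Real.pi) ^ M * (K₁.det ^ s * K₂.det ^ (1 - s))))⁻¹ *
        Real.exp (-(1 / 2) * (y.ofLp ⬝ᵥ (s • K₁⁻¹ + (1 - s) • K₂⁻¹) *ᵥ y.ofLp)) := by
  have hP : (0 : ℝ) < (2 * Real.pi) ^ M := by positivity
  have hconst : (2 * Real.pi) ^ M * (K₁.det ^ s * K₂.det ^ (1 - s)) =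
      ((2 * Real.pi) ^ M * K₁.det) ^ s * ((2 * Real.pi) ^ M * K₂.det) ^ (1 - s) := by
    rw [Real.mul_rpow hP.le h₁.le, Real.mul_rpow hP.le h₂.le, mul_mul_mul_comm,
      ← Real.rpow_add hP, add_sub_cancel, Real.rpow_one]
  have hpow (K : Matrix (Fin M) (Fin M) ℝ) (hK : 0 < K.det) (t : ℝ) :
      gaussianDensity K y ^ t = (√(((2 * Real.pi) ^ M * K.det) ^ t))⁻¹ *
        Real.exp (-(1 / 2) * (y.ofLp ⬝ᵥ (t • K⁻¹) *ᵥ y.ofLp)) := by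
    rw [gaussianDensity, Real.mul_rpow (by positivity) (Real.exp_pos _).le, ← Real.exp_mul,
      Real.inv_rpow (Real.sqrt_nonneg _), ← Real.rpow_div_two_eq_sqrt _ (by positivity),
      Real.sqrt_eq_rpow, ← Real.rpow_mul (by positivity), mul_one_div, Matrix.smul_mulVec,
      dotProduct_smul, smul_eq_mul, mul_assoc, mul_comm t]
  rw [hpow _ h₁, hpow _ h₂, hconst, Real.sqrt_mul (by positivity), mul_inv, Matrix.add_mulVec,
    dotProduct_add, mul_add, Real.exp_add, mul_mul_mul_comm]

theorem overlap_le (h₁ : K₁.PosDef) (h₂ : K₂.PosDef) {s : ℝ} (hs : s ∈ Set.Ioo 0 1) :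
    overlap K₁ K₂ ≤ ENNReal.ofReal
      √(K₁.det ^ (1 - s) * K₂.det ^ s / ((1 - s) • K₁ + s • K₂).det) := by
  have d₁ := h₁.det_pos
  have d₂ := h₂.det_pos
  have hQ : (s • K₁⁻¹ + (1 - s) • K₂⁻¹).PosDef :=
    (h₁.inv.smul hs.1).add (h₂.inv.smul (sub_pos.2 hs.2))
  set P : ℝ := (2 * Real.pi) ^ M
  have hP : 0 < P := by positivity
  have hconst : (√(P * (K₁.det ^ s * K₂.det ^ (1 - s))))⁻¹ *
      √(P / (s • K₁⁻¹ + (1 - s) • K₂⁻¹).det) =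
      √(K₁.det ^ (1 - s) * K₂.det ^ s / ((1 - s) • K₁ + s • K₂).det) := by
    have hmul : K₁.det * K₂.det =
        K₁.det ^ (1 - s) * K₂.det ^ s * (K₁.det ^ s * K₂.det ^ (1 - s)) := by
      rw [mul_mul_mul_comm, ← Real.rpow_add d₁, ← Real.rpow_add d₂,
        sub_add_cancel, add_sub_cancel, Real.rpow_one, Real.rpow_one]
    rw [det_smul_inv_add_smul_inv (isUnit_iff_ne_zero.2 d₁.ne') (isUnit_iff_ne_zero.2 d₂.ne'),
      hmul, sqrt_inv_mul_sqrt_div hP (by positivity) (by positivity)]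
  calc overlap K₁ K₂
      ≤ ∫⁻ y, ENNReal.ofReal (gaussianDensity K₁ y ^ s * gaussianDensity K₂ y ^ (1 - s)) :=
        lintegral_mono fun y => ENNReal.ofReal_le_ofReal <| min_le_rpow_mul_rpow
          (gaussianDensity_pos d₁ y) (gaussianDensity_pos d₂ y) ⟨hs.1.le, hs.2.le⟩
    _ = ENNReal.ofReal √(K₁.det ^ (1 - s) * K₂.det ^ s / ((1 - s) • K₁ + s • K₂).det) := by
        simp only [gaussianDensity_rpow_mul_rpow d₁ d₂,
          ENNReal.ofReal_mul (inv_nonneg.2 (Real.sqrt_nonneg _))]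
        rw [lintegral_const_mul' _ _ ENNReal.ofReal_ne_top,
          lintegral_exp_neg_half_dotProduct_mulVec hQ,
          ← ENNReal.ofReal_mul (inv_nonneg.2 (Real.sqrt_nonneg _)), hconst]

end Overlap

section PairExponent

variable {M : ℕ} {A₁ A₂ : Matrix (Fin M) (Fin M) ℝ}

/-- The exponent `(rank (A₁ + A₂) - min (rank A₁) (rank A₂)) / 2` with which the overlap of the
Gaussian laws with covariances `A₁ + v I` and `A₂ + v I` decays as the noise level `v` vanishes. -/
noncomputable def pairExponent (A₁ A₂ : Matrix (Fin M) (Fin M) ℝ) : ℝ :=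
  (((A₁ + A₂).rank : ℝ) - min (A₁.rank : ℝ) A₂.rank) / 2

theorem hasOrder_det_smul_add_smul (h₁ : A₁.PosSemidef) (h₂ : A₂.PosSemidef) {s t : ℝ}
    (hs : 0 < s) (ht : 0 < t) :
    HasOrder (fun v => (s • (A₁ + v • (1 : Matrix (Fin M) (Fin M) ℝ)) +
      t • (A₂ + v • (1 : Matrix (Fin M) (Fin M) ℝ))).det) (M - (A₁ + A₂).rank) := by
  have h := hasOrder_det_add_mul_smul_one ((h₁.smul hs.le).add (h₂.smul ht.le)) (add_pos hs ht)
  rw [rank_smul_add_smul h₁ h₂ hs ht, Fintype.card_fin] at h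
  refine (congrArg (HasOrder · _) (funext fun v => congrArg Matrix.det ?_)).mp h
  module

theorem hasOrder_det_add_smul_one (h₁ : A₁.PosSemidef) :
    HasOrder (fun v => (A₁ + v • (1 : Matrix (Fin M) (Fin M) ℝ)).det) (M - A₁.rank) := by
  simpa only [one_mul, Fintype.card_fin] using hasOrder_det_add_mul_smul_one h₁ one_pos

theorem decaysAtMost_overlap (h₁ : A₁.PosSemidef) (h₂ : A₂.PosSemidef) :
    DecaysAtMost (fun v => overlap (A₁ + v • 1) (A₂ + v • 1)) (pairExponent A₁ A₂) := by
  have hsum : HasOrder (fun v => (A₁ + v • (1 : Matrix (Fin M) (Fin M) ℝ) + (A₂ + v • 1)).det)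
      (M - (A₁ + A₂).rank) := by
    simpa only [one_smul] using hasOrder_det_smul_add_smul h₁ h₂ one_pos one_pos
  have horder := ((hasOrder_det_add_smul_one h₁).div hsum).sqrt.min
    ((hasOrder_det_add_smul_one h₂).div hsum).sqrt
  have hexp : max (((M - A₁.rank : ℝ) - (M - (A₁ + A₂).rank)) / 2)
      (((M - A₂.rank : ℝ) - (M - (A₁ + A₂).rank)) / 2) = pairExponent A₁ A₂ := by
    rw [max_div_div_right (zero_le_two (α := ℝ)), sub_sub_sub_cancel_left, sub_sub_sub_cancel_left,
      max_sub_sub_left, pairExponent]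
  rw [hexp] at horder
  refine horder.decaysAtMost.mono ?_
  filter_upwards [self_mem_nhdsWithin] with v hv
  exact le_overlap (posDef_add_smul_one h₁ hv) (posDef_add_smul_one h₂ hv)

theorem exists_mem_Ioo_convexComb_lt {a b x : ℝ} (h : min a b < x) :
    ∃ s ∈ Set.Ioo (0 : ℝ) 1, (1 - s) * a + s * b < x := by
  have hcont : Continuous fun s : ℝ => (1 - s) * a + s * b := by fun_prop
  rcases min_lt_iff.1 h with h | h
  · have hev := (hcont.tendsto 0).eventually_lt_const (u := x) (by simpa using h)
    exact (((hev.filter_mono nhdsWithin_le_nhds).and (Ioo_mem_nhdsGT one_pos)).exists).imp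
      fun s hs => hs.symm
  · have hev := (hcont.tendsto 1).eventually_lt_const (u := x) (by simpa using h)
    exact (((hev.filter_mono nhdsWithin_le_nhds).and (Ioo_mem_nhdsLT one_pos)).exists).imp
      fun s hs => hs.symm

theorem decaysAtLeast_overlap (h₁ : A₁.PosSemidef) (h₂ : A₂.PosSemidef) :
    DecaysAtLeast (fun v => overlap (A₁ + v • 1) (A₂ + v • 1)) (pairExponent A₁ A₂) := by
  intro d hd
  have hd : d < pairExponent A₁ A₂ := EReal.coe_lt_coe_iff.1 hd
  obtain ⟨s, hs, hlt⟩ := exists_mem_Ioo_convexComb_lt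
    (show min (A₁.rank : ℝ) A₂.rank < (A₁ + A₂).rank - 2 * d by
      rw [pairExponent] at hd
      linarith)
  have horder := ((((hasOrder_det_add_smul_one h₁).rpow (1 - s)).mul
    ((hasOrder_det_add_smul_one h₂).rpow s)).div
      (hasOrder_det_smul_add_smul h₁ h₂ (sub_pos.2 hs.2) hs.1)).sqrt
  filter_upwards [horder.eventually_le_rpow (d := d) (by linarith), self_mem_nhdsWithin]
    with v hle hv
  exact (overlap_le (posDef_add_smul_one h₁ hv) (posDef_add_smul_one h₂ hv) hs).trans
    (ENNReal.ofReal_le_ofReal hle)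

end PairExponent

/-! ### The error probability of the MAP classifier -/

section ErrorProb

variable {L M N : ℕ} {p : Fin L → ℝ} {S : Fin L → Matrix (Fin N) (Fin N) ℝ}
  {Φ : Matrix (Fin M) (Fin N) ℝ} {v : ℝ} {c : EuclideanSpace ℝ (Fin M) → Fin L}

theorem min_mul_overlap_le_errorProb (hp : ∀ i, 0 ≤ p i) (hS : ∀ i, (S i).PosSemidef) (hv : 0 < v)
    (hc : Measurable c) {i j : Fin L} (hij : i ≠ j) :
    ENNReal.ofReal (min (p i) (p j)) *
        overlap (Φ * S i * Φᵀ + v • 1) (Φ * S j * Φᵀ + v • 1) ≤ errorProb p S Φ v c := by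
  have hm (k : Fin L) : MeasurableSet {y | c y ≠ k} := (hc (measurableSet_singleton k)).compl
  have hsub : {y | c y ≠ i}ᶜ ⊆ {y | c y ≠ j} := fun y hy => by
    rw [Set.mem_ofPred_eq, not_not.1 hy]
    exact hij
  have hle (k : Fin L) (hk : min (p i) (p j) ≤ p k) (y : EuclideanSpace ℝ (Fin M))
      (hky : min (classDensity Φ (S i) v y) (classDensity Φ (S j) v y) ≤
        classDensity Φ (S k) v y) :
      ENNReal.ofReal (min (p i) (p j)) *
        ENNReal.ofReal (min (classDensity Φ (S i) v y) (classDensity Φ (S j) v y)) ≤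
      ENNReal.ofReal (p k * classDensity Φ (S k) v y) := by
    rw [ENNReal.ofReal_mul (hp k)]
    exact mul_le_mul' (ENNReal.ofReal_le_ofReal hk) (ENNReal.ofReal_le_ofReal hky)
  calc ENNReal.ofReal (min (p i) (p j)) *
        overlap (Φ * S i * Φᵀ + v • 1) (Φ * S j * Φᵀ + v • 1)
      = ∫⁻ y, ENNReal.ofReal (min (p i) (p j)) *
          ENNReal.ofReal (min (classDensity Φ (S i) v y) (classDensity Φ (S j) v y)) :=
        (lintegral_const_mul' _ _ ENNReal.ofReal_ne_top).symm
    _ ≤ (∫⁻ y in {y | c y ≠ i}, ENNReal.ofReal (p i * classDensity Φ (S i) v y)) +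
          ∫⁻ y in {y | c y ≠ j}, ENNReal.ofReal (p j * classDensity Φ (S j) v y) := by
        rw [← lintegral_add_compl _ (hm i)]
        exact add_le_add (lintegral_mono fun y => hle i (min_le_left _ _) y (min_le_left _ _))
          (lintegral_mono' (Measure.restrict_mono_set _ hsub)
            fun y => hle j (min_le_right _ _) y (min_le_right _ _))
    _ = ∑ k ∈ {i, j}, ENNReal.ofReal (p k) * measurementLaw Φ (S k) v {y | c y ≠ k} := by
        rw [Finset.sum_pair hij, ofReal_mul_measurementLaw_apply Φ (hS i) hv (hp i) (hm i),
          ofReal_mul_measurementLaw_apply Φ (hS j) hv (hp j) (hm j)]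
    _ ≤ errorProb p S Φ v c := Finset.sum_le_sum_of_subset (Finset.subset_univ _)

theorem ofReal_mul_measurementLaw_setOf_eq_le (hp : ∀ i, 0 ≤ p i) (hS : ∀ i, (S i).PosSemidef)
    (hv : 0 < v) (hc : IsMAP p S Φ v c) (i j : Fin L) :
    ENNReal.ofReal (p i) * measurementLaw Φ (S i) v {y | c y = j} ≤
      if 0 < p i ∧ 0 < p j then ENNReal.ofReal (max (p i) (p j)) *
        overlap (Φ * S i * Φᵀ + v • 1) (Φ * S j * Φᵀ + v • 1) else 0 := by
  have hm : MeasurableSet {y | c y = j} := hc.1 (measurableSet_singleton j)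
  have hmap (y : EuclideanSpace ℝ (Fin M)) (hy : c y = j) :
      p i * classDensity Φ (S i) v y ≤ p j * classDensity Φ (S j) v y := hy ▸ hc.2 y i
  rw [ofReal_mul_measurementLaw_apply Φ (hS i) hv (hp i) hm]
  split_ifs with hpos
  · rw [overlap, ← lintegral_const_mul' _ _ ENNReal.ofReal_ne_top]
    refine (setLIntegral_mono' hm fun y hy => ?_).trans (setLIntegral_le_lintegral _ _)
    rw [← ENNReal.ofReal_mul ((hp i).trans (le_max_left _ _)),
      mul_min_of_nonneg _ _ ((hp i).trans (le_max_left _ _))]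
    refine ENNReal.ofReal_le_ofReal (le_min ?_ ((hmap y hy).trans ?_)) <;>
    refine mul_le_mul_of_nonneg_right ?_ (gaussianDensity_nonneg _ _)
    exacts [le_max_left _ _, le_max_right _ _]
  · refine (setLIntegral_eq_zero hm fun y hy => ENNReal.ofReal_of_nonpos ?_).le
    rcases not_and_or.1 hpos with h | h
    · exact mul_nonpos_of_nonpos_of_nonneg (not_lt.1 h) (gaussianDensity_nonneg _ _)
    · exact (hmap y hy).trans
        (mul_nonpos_of_nonpos_of_nonneg (not_lt.1 h) (gaussianDensity_nonneg _ _))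

/-- The pairs of distinct classes of positive probability: the only ones whose confusion
contributes to the error. -/
noncomputable def competingPairs (p : Fin L → ℝ) : Finset (Fin L × Fin L) :=
  {q | q.1 ≠ q.2 ∧ 0 < p q.1 ∧ 0 < p q.2}

theorem errorProb_le_sum_overlap (hp : ∀ i, 0 ≤ p i) (hS : ∀ i, (S i).PosSemidef) (hv : 0 < v)
    (hc : IsMAP p S Φ v c) :
    errorProb p S Φ v c ≤ ∑ q ∈ competingPairs p, ENNReal.ofReal (max (p q.1) (p q.2)) *
      overlap (Φ * S q.1 * Φᵀ + v • 1) (Φ * S q.2 * Φᵀ + v • 1) := by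
  have hunion (i : Fin L) :
      {y | c y ≠ i} = ⋃ j ∈ Finset.univ.filter (i ≠ ·), {y | c y = j} := by
    ext y
    simp [eq_comm]
  rw [competingPairs, Finset.sum_filter, Fintype.sum_prod_type]
  refine Finset.sum_le_sum fun i _ => ?_
  calc ENNReal.ofReal (p i) * measurementLaw Φ (S i) v {y | c y ≠ i}
      ≤ ENNReal.ofReal (p i) *
          ∑ j with i ≠ j, measurementLaw Φ (S i) v {y | c y = j} := by
        rw [hunion]
        exact mul_le_mul_right (measure_biUnion_finset_le _ _) _
    _ ≤ ∑ j with i ≠ j, if 0 < p i ∧ 0 < p j then ENNReal.ofReal (max (p i) (p j)) *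
          overlap (Φ * S i * Φᵀ + v • 1) (Φ * S j * Φᵀ + v • 1) else 0 := by
        rw [Finset.mul_sum]
        exact Finset.sum_le_sum fun j _ => ofReal_mul_measurementLaw_setOf_eq_le hp hS hv hc i j
    _ = _ := by
        simp only [Finset.sum_filter, ite_and]

/-- The decay exponent of the MAP error for the design `Φ`: the smallest exponent over the
competing pairs, which is `⊤` when there are none. -/
noncomputable def errorExponent (p : Fin L → ℝ) (S : Fin L → Matrix (Fin N) (Fin N) ℝ)
    (Φ : Matrix (Fin M) (Fin N) ℝ) : EReal :=
  (competingPairs p).inf fun q => (pairExponent (Φ * S q.1 * Φᵀ) (Φ * S q.2 * Φᵀ) : EReal)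

theorem tendsto_neg_log_errorProb_div_log (hp : ∀ i, 0 ≤ p i) (hS : ∀ i, (S i).PosSemidef)
    {c : ℝ → EuclideanSpace ℝ (Fin M) → Fin L} (hc : ∀ v, 0 < v → IsMAP p S Φ v (c v)) :
    Tendsto (fun v : ℝ => -(errorProb p S Φ v (c v)).log / ((Real.log (1 / v) : ℝ) : EReal))
      (𝓝[>] 0) (𝓝 (errorExponent p S Φ)) := by
  have hA (i : Fin L) : (Φ * S i * Φᵀ).PosSemidef := by
    simpa only [Matrix.conjTranspose_eq_transpose_of_trivial] using
      (hS i).mul_mul_conjTranspose_same Φ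
  refine tendsto_neg_log_div_log ?_ fun d hd => ?_
  · exact DecaysAtLeast.mono (DecaysAtLeast.sum (s := competingPairs p) fun q hq =>
      ((decaysAtLeast_overlap (hA q.1) (hA q.2)).const_mul ENNReal.ofReal_ne_top).anti
        (Finset.inf_le hq))
      (eventually_mem_nhdsWithin.mono fun v hv => errorProb_le_sum_overlap hp hS hv (hc v hv))
  · obtain ⟨q, hq, hqd⟩ := Finset.inf_lt_iff.1 hd
    obtain ⟨hne, hp₁, hp₂⟩ := (Finset.mem_filter.1 hq).2
    refine ((decaysAtMost_overlap (hA q.1) (hA q.2)).const_mul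
      (ENNReal.ofReal_pos.2 (lt_min hp₁ hp₂)).ne' ENNReal.ofReal_ne_top).mono ?_ d hqd
    filter_upwards [self_mem_nhdsWithin] with v hv
    exact min_mul_overlap_le_errorProb hp hS hv (hc v hv).1 hne

theorem decayExponentGT_of_lt_pairExponent (hp : ∀ i, 0 ≤ p i) (hS : ∀ i, (S i).PosSemidef)
    {d₀ : ℝ} (h : ∀ i j, i ≠ j → d₀ < pairExponent (Φ * S i * Φᵀ) (Φ * S j * Φᵀ)) :
    DecayExponentGT p S Φ d₀ := fun _ hc =>
  ⟨errorExponent p S Φ, tendsto_neg_log_errorProb_div_log hp hS hc,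
    (Finset.lt_inf_iff (EReal.coe_lt_top d₀)).2 fun q hq =>
      EReal.coe_lt_coe_iff.2 (h q.1 q.2 (Finset.mem_filter.1 hq).2.1)⟩

end ErrorProb

/-! ### Coordinate subspaces in general position -/

section CoordinateDesign

variable {ι κ τ : Type*} [DecidableEq ι]

theorem exists_finset_card_fiber_le [Fintype ι] [Fintype τ] (b : τ → ι) (k : ι → ℕ) {n : ℕ}
    (hn : n ≤ ∑ l, min (Finset.univ.filter (b · = l)).card (k l)) :
    ∃ T : Finset τ, T.card = n ∧ ∀ l, (T.filter (b · = l)).card ≤ k l := by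
  classical
  choose F hF hcard using fun l => Finset.exists_subset_card_eq
    (min_le_left (Finset.univ.filter (b · = l)).card (k l))
  have hb {l : ι} {q : τ} (hq : q ∈ F l) : b q = l := (Finset.mem_filter.1 (hF l hq)).2
  have hdisj : (Set.univ : Set ι).PairwiseDisjoint F := fun l _ l' _ hl =>
    Finset.disjoint_left.2 fun q hq hq' => hl ((hb hq).symm.trans (hb hq'))
  obtain ⟨T, hT, hTn⟩ := Finset.exists_subset_card_eq (s := Finset.univ.biUnion F) (n := n) (by
    rwa [Finset.card_biUnion fun l _ l' _ hl => hdisj trivial trivial hl,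
      Finset.sum_congr rfl fun l _ => hcard l])
  refine ⟨T, hTn, fun l => le_trans (Finset.card_le_card fun q hq => ?_)
    ((hcard l).trans_le (min_le_right _ _))⟩
  obtain ⟨hqT, rfl⟩ := Finset.mem_filter.1 hq
  obtain ⟨l, -, hql⟩ := Finset.mem_biUnion.1 (hT hqT)
  rwa [hb hql]

theorem exists_card_eq_card_eq_le_card_union [Fintype κ] [DecidableEq κ] {r : ℕ}
    (hr : r ≤ Fintype.card κ) :
    ∃ A B : Finset κ, A.card = r ∧ B.card = r ∧ min (Fintype.card κ) (2 * r) ≤ (A ∪ B).card := by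
  obtain ⟨W, -, hW⟩ := Finset.exists_subset_card_eq (s := (Finset.univ : Finset κ))
    (min_le_left (Fintype.card κ) (2 * r))
  obtain ⟨A, hAW, hA⟩ := Finset.exists_subset_card_eq (s := W) (n := r) (by omega)
  have hWA := Finset.card_sdiff_of_subset hAW
  obtain ⟨B, hB, -, hBr⟩ := Finset.exists_subsuperset_card_eq
    (Finset.subset_univ (W \ A)) (n := r) (by omega) (by rwa [Finset.card_univ])
  refine ⟨A, B, hA, hBr, hW.symm.trans_le (Finset.card_le_card fun x hx => ?_)⟩
  by_cases hxA : x ∈ A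
  · exact Finset.mem_union_left _ hxA
  · exact Finset.mem_union_right _ (hB (Finset.mem_sdiff.2 ⟨hx, hxA⟩))

theorem exists_injective_mem_of_fibers [Fintype τ] (b : τ → ι) {i j : ι}
    {t : τ → Finset κ} {U V : Finset κ} (hUV : Disjoint U V) (hti : ∀ s, b s = i → t s = U)
    (htj : ∀ s, b s = j → t s = V)
    (hother : ∀ s, b s ≠ i → b s ≠ j → Fintype.card τ ≤ (t s).card)
    (hi : (Finset.univ.filter (b · = i)).card ≤ U.card)
    (hj : (Finset.univ.filter (b · = j)).card ≤ V.card) :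
    ∃ c : τ → κ, Function.Injective c ∧ ∀ s, c s ∈ t s := by
  classical
  refine (Finset.all_card_le_biUnion_card_iff_exists_injective t).1 fun T => ?_
  by_cases h : ∃ s ∈ T, b s ≠ i ∧ b s ≠ j
  · obtain ⟨s, hs, hsi, hsj⟩ := h
    exact (Finset.card_le_univ T).trans ((hother s hsi hsj).trans
      (Finset.card_le_card (Finset.subset_biUnion_of_mem t hs)))
  have hle {l : ι} {W : Finset κ} (hW : ∀ s, b s = l → t s = W)
      (hl : (Finset.univ.filter (b · = l)).card ≤ W.card) :
      (T.filter (b · = l)).card ≤ (T.biUnion t ∩ W).card := by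
    rcases (T.filter (b · = l)).eq_empty_or_nonempty with h | ⟨s, hs⟩
    · simp [h]
    · obtain ⟨hsT, hsl⟩ := Finset.mem_filter.1 hs
      rw [Finset.inter_eq_right.2 (hW s hsl ▸ Finset.subset_biUnion_of_mem t hsT)]
      exact (Finset.card_le_card (Finset.filter_subset_filter _ (Finset.subset_univ T))).trans hl
  have hT : T ⊆ T.filter (b · = i) ∪ T.filter (b · = j) := fun s hs => by
    by_contra hs'
    simp only [Finset.mem_union, Finset.mem_filter, hs, true_and, not_or] at hs'
    exact h ⟨s, hs, hs'⟩
  calc T.card ≤ (T.filter (b · = i)).card + (T.filter (b · = j)).card :=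
        (Finset.card_le_card hT).trans (Finset.card_union_le _ _)
    _ ≤ (T.biUnion t ∩ U).card + (T.biUnion t ∩ V).card := add_le_add (hle hti hi) (hle htj hj)
    _ = (T.biUnion t ∩ U ∪ T.biUnion t ∩ V).card := (Finset.card_union_of_disjoint
        (hUV.mono Finset.inter_subset_right Finset.inter_subset_right)).symm
    _ ≤ (T.biUnion t).card :=
        Finset.card_le_card (Finset.union_subset Finset.inter_subset_left Finset.inter_subset_left)

theorem exists_injective_mem_sdiff [Fintype τ] [DecidableEq κ] (b : τ → ι) {i j : ι} (hij : i ≠ j)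
    {A B : Finset κ} (hAB : Fintype.card τ ≤ (A ∪ B).card)
    (hi : (Finset.univ.filter (b · = i)).card ≤ (B \ A).card)
    (hj : (Finset.univ.filter (b · = j)).card ≤ (A \ B).card) :
    ∃ c : τ → κ, Function.Injective c ∧ (∀ s, c s ∈ A ∪ B) ∧ (∀ s, b s = i → c s ∈ B \ A) ∧
      ∀ s, b s = j → c s ∈ A \ B := by
  set t : τ → Finset κ := fun s => if b s = i then B \ A else if b s = j then A \ B else A ∪ B
  have hti (s : τ) (hs : b s = i) : t s = B \ A := if_pos hs
  have htj (s : τ) (hs : b s = j) : t s = A \ B :=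
    (if_neg (hs.trans_ne hij.symm)).trans (if_pos hs)
  have hto {s : τ} (hs : b s ≠ i) (hs' : b s ≠ j) : t s = A ∪ B := (if_neg hs).trans (if_neg hs')
  obtain ⟨c, hc, hct⟩ := exists_injective_mem_of_fibers b disjoint_sdiff_sdiff hti htj
    (fun s hs hs' => by rwa [hto hs hs']) hi hj
  refine ⟨c, hc, fun s => ?_, fun s hs => hti s hs ▸ hct s, fun s hs => htj s hs ▸ hct s⟩
  by_cases hs : b s = i
  · exact Finset.mem_union_right _ (Finset.sdiff_subset (hti s hs ▸ hct s))
  by_cases hs' : b s = j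
  · exact Finset.mem_union_left _ (Finset.sdiff_subset (htj s hs' ▸ hct s))
  · exact hto hs hs' ▸ hct s

theorem exists_coordinate_design [Fintype τ] [Fintype κ] [DecidableEq κ] (b : τ → ι) {i j : ι}
    (hij : i ≠ j) {r : ℕ} (hτ : Fintype.card τ ≤ min (Fintype.card κ) (2 * r))
    (hb : ∀ l, (Finset.univ.filter (b · = l)).card + r ≤ Fintype.card κ)
    (hi : (Finset.univ.filter (b · = i)).card ≤ r)
    (hj : (Finset.univ.filter (b · = j)).card ≤ r) :
    ∃ (A : ι → Finset κ) (c : τ → κ), (∀ l, (A l).card = r) ∧ Function.Injective c ∧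
      (∀ s, c s ∉ A (b s)) ∧ ∀ s, c s ∈ A i ∪ A j := by
  obtain ⟨A, B, hA, hB, hAB⟩ := exists_card_eq_card_eq_le_card_union (le_of_add_le_right (hb i))
  have hA' := Finset.card_sdiff_add_card A B
  have hB' := Finset.card_sdiff_add_card B A
  rw [Finset.union_comm] at hB'
  have hbi := hb i
  have hbj := hb j
  obtain ⟨c, hc, hcAB, hci, hcj⟩ := exists_injective_mem_sdiff b hij (hτ.trans hAB) (by omega)
    (by omega)
  have havoid (l : ι) : ∃ D : Finset κ, D.card = r ∧ ∀ s, b s = l → c s ∉ D := by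
    have hcard := Finset.card_image_le (s := Finset.univ.filter (b · = l)) (f := c)
    have hcompl := Finset.card_compl ((Finset.univ.filter (b · = l)).image c)
    have hbl := hb l
    obtain ⟨D, hD, hDr⟩ := Finset.exists_subset_card_eq
      (s := ((Finset.univ.filter (b · = l)).image c)ᶜ) (n := r) (by omega)
    exact ⟨D, hDr, fun s hs hcD => Finset.mem_compl.1 (hD hcD)
      (Finset.mem_image_of_mem c (Finset.mem_filter.2 ⟨Finset.mem_univ s, hs⟩))⟩
  choose D hD hcD using havoid
  refine ⟨Function.update (Function.update D i A) j B, c, fun l => ?_, hc, fun s => ?_,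
    fun s => ?_⟩
  · simp only [Function.update_apply]
    split_ifs
    exacts [hB, hA, hD l]
  · simp only [Function.update_apply]
    split_ifs with hsj hsi
    exacts [(Finset.mem_sdiff.1 (hcj s hsj)).2, (Finset.mem_sdiff.1 (hci s hsi)).2, hcD _ s rfl]
  · rw [Function.update_self, Function.update_of_ne hij, Function.update_self]
    exact hcAB s

end CoordinateDesign

/-! ### Zero sets of polynomial functions -/

/-- A polynomial function on a real vector space, in the coordinate-free form needed to show that
its zero set is negligible: it is continuous and restricts to a polynomial on every line. -/
def PolynomialOnLines {E : Type*} [NormedAddCommGroup E] [NormedSpace ℝ E] (f : E → ℝ) : Prop :=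
  Continuous f ∧ ∀ x y, ∃ p : Polynomial ℝ, ∀ t : ℝ, f (x + t • y) = p.eval t

namespace PolynomialOnLines

variable {E : Type*} [NormedAddCommGroup E] [NormedSpace ℝ E] {f g : E → ℝ}

theorem const (c : ℝ) : PolynomialOnLines fun _ : E => c :=
  ⟨continuous_const, fun _ _ => ⟨Polynomial.C c, fun _ => Polynomial.eval_C.symm⟩⟩

theorem of_continuousLinearMap (f : E →L[ℝ] ℝ) : PolynomialOnLines fun x => f x :=
  ⟨f.continuous, fun x y => ⟨Polynomial.C (f x) + Polynomial.X * Polynomial.C (f y), fun t => by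
    simp only [map_add, map_smul, smul_eq_mul, Polynomial.eval_add, Polynomial.eval_mul,
      Polynomial.eval_C, Polynomial.eval_X]⟩⟩

theorem mul (hf : PolynomialOnLines f) (hg : PolynomialOnLines g) :
    PolynomialOnLines fun x => f x * g x :=
  ⟨hf.1.mul hg.1, fun x y => by
    obtain ⟨p, hp⟩ := hf.2 x y
    obtain ⟨q, hq⟩ := hg.2 x y
    exact ⟨p * q, fun t => by simp only [hp, hq, Polynomial.eval_mul]⟩⟩

theorem sub (hf : PolynomialOnLines f) (hg : PolynomialOnLines g) :
    PolynomialOnLines fun x => f x - g x :=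
  ⟨hf.1.sub hg.1, fun x y => by
    obtain ⟨p, hp⟩ := hf.2 x y
    obtain ⟨q, hq⟩ := hg.2 x y
    exact ⟨p - q, fun t => by simp only [hp, hq, Polynomial.eval_sub]⟩⟩

theorem add (hf : PolynomialOnLines f) (hg : PolynomialOnLines g) :
    PolynomialOnLines fun x => f x + g x :=
  ⟨hf.1.add hg.1, fun x y => by
    obtain ⟨p, hp⟩ := hf.2 x y
    obtain ⟨q, hq⟩ := hg.2 x y
    exact ⟨p + q, fun t => by simp only [hp, hq, Polynomial.eval_add]⟩⟩

theorem sum {ι : Type*} (s : Finset ι) {F : ι → E → ℝ} (hF : ∀ i, PolynomialOnLines (F i)) :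
    PolynomialOnLines fun x => ∑ i ∈ s, F i x :=
  ⟨continuous_finsetSum _ fun i _ => (hF i).1, fun x y => by
    choose p hp using fun i => (hF i).2 x y
    exact ⟨∑ i ∈ s, p i, fun t => by simp only [hp, Polynomial.eval_finsetSum]⟩⟩

theorem prod {ι : Type*} (s : Finset ι) {F : ι → E → ℝ} (hF : ∀ i, PolynomialOnLines (F i)) :
    PolynomialOnLines fun x => ∏ i ∈ s, F i x :=
  ⟨continuous_finsetProd _ fun i _ => (hF i).1, fun x y => by
    choose p hp using fun i => (hF i).2 x y
    exact ⟨∏ i ∈ s, p i, fun t => by simp only [hp, Polynomial.eval_prod]⟩⟩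

theorem det {n : Type*} [Fintype n] [DecidableEq n] {A : E → Matrix n n ℝ}
    (hA : ∀ i j, PolynomialOnLines fun x => A x i j) : PolynomialOnLines fun x => (A x).det := by
  simp only [Matrix.det_apply']
  exact sum _ fun σ => (const _).mul (prod _ fun i => hA _ _)

theorem adjugate {n : Type*} [Fintype n] [DecidableEq n] {A : E → Matrix n n ℝ}
    (hA : ∀ i j, PolynomialOnLines fun x => A x i j) (i j : n) :
    PolynomialOnLines fun x => (A x).adjugate i j := by
  simp only [Matrix.adjugate_apply]
  refine det fun k l => ?_
  by_cases h : k = j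
  · simpa only [h, Matrix.updateRow_self] using const _
  · simpa only [Matrix.updateRow_ne h] using hA k l

theorem matrix_mul {l m n : Type*} [Fintype m] {A : E → Matrix l m ℝ} {B : E → Matrix m n ℝ}
    (hA : ∀ i j, PolynomialOnLines fun x => A x i j)
    (hB : ∀ i j, PolynomialOnLines fun x => B x i j) (i : l) (j : n) :
    PolynomialOnLines fun x => (A x * B x) i j := by
  simp only [Matrix.mul_apply]
  exact sum _ fun k => (hA i k).mul (hB k j)

theorem ae_ne_zero_on_line (hf : PolynomialOnLines f) {x : E} (hx : f x ≠ 0) (y : E) :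
    ∀ᵐ t : ℝ, f (x + t • y) ≠ 0 := by
  obtain ⟨p, hp⟩ := hf.2 x y
  have hp0 : p ≠ 0 := by
    rintro rfl
    exact hx (by simpa only [zero_smul, add_zero, Polynomial.eval_zero] using hp 0)
  have hroots : {t : ℝ | ¬f (x + t • y) ≠ 0} = p.rootSet ℝ := by
    ext t
    simp only [ne_eq, not_not, hp, Polynomial.mem_rootSet, Polynomial.coe_aeval_eq_eval]
    exact (and_iff_right hp0).symm
  rw [ae_iff, hroots]
  exact (p.rootSet_finite ℝ).measure_zero volume

theorem ae_ne_zero [FiniteDimensional ℝ E] [MeasurableSpace E] [BorelSpace E] (μ : Measure E)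
    [μ.IsAddHaarMeasure] (hf : PolynomialOnLines f) {x₀ : E} (h₀ : f x₀ ≠ 0) :
    ∀ᵐ x ∂μ, f x ≠ 0 := by
  have hmeas : MeasurableSet {q : E × ℝ | f (x₀ + q.2 • q.1) ≠ 0} := by
    have : Continuous fun q : E × ℝ => f (x₀ + q.2 • q.1) := hf.1.comp (by fun_prop)
    exact (this.measurable (measurableSet_singleton 0)).compl
  have hcomm : ∀ᵐ t : ℝ, ∀ᵐ y ∂μ, f (x₀ + t • y) ≠ 0 :=
    (Measure.ae_ae_comm (p := fun y t => f (x₀ + t • y) ≠ 0) hmeas).1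
      (Eventually.of_forall (hf.ae_ne_zero_on_line h₀))
  obtain ⟨t, ht, ht0⟩ := (hcomm.and (Measure.ae_ne volume (0 : ℝ))).exists
  have hpreimage : {y | ¬f (x₀ + t • y) ≠ 0} =
      (fun y => t • y) ⁻¹' ((fun y => x₀ + y) ⁻¹' {x | ¬f x ≠ 0}) := rfl
  rw [ae_iff, hpreimage, Measure.addHaar_preimage_smul μ ht0, measure_preimage_add,
    mul_eq_zero] at ht
  exact ae_iff.2 (ht.resolve_left
    (ENNReal.ofReal_pos.2 (abs_pos.2 (inv_ne_zero (pow_ne_zero _ ht0)))).ne')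

end PolynomialOnLines

/-! ### Designs orthogonal to the class subspaces -/

section ProjectedRank

variable {l n : Type*} [Fintype n]

theorem rank_mul_le_of_range_le [DecidableEq n] (Φ : Matrix l n ℝ) {A B : Matrix n n ℝ}
    (h : LinearMap.range A.toEuclideanLin ≤ LinearMap.range B.toEuclideanLin) :
    (Φ * A).rank ≤ (Φ * B).rank := by
  have h' : LinearMap.range A.mulVecLin ≤ LinearMap.range B.mulVecLin := by
    rintro _ ⟨w, rfl⟩
    obtain ⟨u, hu⟩ := h ⟨WithLp.toLp 2 w, rfl⟩
    exact ⟨u.ofLp, congrArg WithLp.ofLp hu⟩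
  rw [Matrix.rank, Matrix.rank, Matrix.mulVecLin_mul, Matrix.mulVecLin_mul, LinearMap.range_comp,
    LinearMap.range_comp]
  exact Submodule.finrank_mono (Submodule.map_mono h')

theorem rank_mul_mul_transpose [Fintype l] (Φ : Matrix l n ℝ) {S : Matrix n n ℝ}
    (hS : S.PosSemidef) : (Φ * S * Φᵀ).rank = (Φ * S).rank := by
  classical
  obtain ⟨B, rfl⟩ := CStarAlgebra.nonneg_iff_eq_star_mul_self.1 hS.nonneg
  have hgram : Φ * (star B * B) * Φᵀ = (Φ * Bᵀ) * (Φ * Bᵀ)ᵀ := by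
    simp only [Matrix.star_eq_conjTranspose, Matrix.conjTranspose_eq_transpose_of_trivial,
      Matrix.transpose_mul, Matrix.transpose_transpose, Matrix.mul_assoc]
  refine le_antisymm (Matrix.rank_mul_le_left _ _) ?_
  rw [hgram, Matrix.rank_self_mul_transpose, ← Matrix.mul_assoc]
  exact Matrix.rank_mul_le_left _ _

end ProjectedRank

section DesignMatrix

variable {ι Q n : Type*} [Fintype n]

/-- The matrix of the orthogonal projection of `ℝⁿ` onto `V`. -/
noncomputable def projMatrix [DecidableEq n] (V : Submodule ℝ (EuclideanSpace ℝ n)) :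
    Matrix n n ℝ :=
  Matrix.toEuclideanLin.symm V.starProjection

/-- The designed measurement matrix: the row `q`, assigned to the class `b q`, is the component of
the vector `z q` orthogonal to the subspace `P (b q)`, so that it does not see that class. -/
noncomputable def designMatrix (b : Q → ι) (P : ι → Submodule ℝ (EuclideanSpace ℝ n))
    (z : Q → EuclideanSpace ℝ n) : Matrix Q n ℝ :=
  Matrix.of fun q => (z q - (P (b q)).starProjection (z q)).ofLp

variable [DecidableEq n]

theorem toEuclideanLin_projMatrix (V : Submodule ℝ (EuclideanSpace ℝ n)) :
    (projMatrix V).toEuclideanLin = V.starProjection :=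
  Matrix.toEuclideanLin.apply_symm_apply _

theorem projMatrix_mulVec (V : Submodule ℝ (EuclideanSpace ℝ n)) (x : EuclideanSpace ℝ n) :
    projMatrix V *ᵥ x.ofLp = (V.starProjection x).ofLp :=
  congrArg WithLp.ofLp (LinearMap.congr_fun (toEuclideanLin_projMatrix V) x)

theorem range_projMatrix (V : Submodule ℝ (EuclideanSpace ℝ n)) :
    LinearMap.range (projMatrix V).toEuclideanLin = V := by
  rw [toEuclideanLin_projMatrix]
  exact V.range_starProjection

theorem posSemidef_projMatrix (V : Submodule ℝ (EuclideanSpace ℝ n)) :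
    (projMatrix V).PosSemidef := by
  rw [← Matrix.isPositive_toEuclideanLin_iff, toEuclideanLin_projMatrix]
  exact V.isSymmetricProjection_starProjection.isPositive

theorem designMatrix_apply (b : Q → ι) (P : ι → Submodule ℝ (EuclideanSpace ℝ n))
    (z : Q → EuclideanSpace ℝ n) (q : Q) :
    designMatrix b P z q = (z q).ofLp - projMatrix (P (b q)) *ᵥ (z q).ofLp := by
  rw [projMatrix_mulVec]
  rfl

theorem designMatrix_mul_row_eq_zero (b : Q → ι) (P : ι → Submodule ℝ (EuclideanSpace ℝ n))
    (z : Q → EuclideanSpace ℝ n) {S : Matrix n n ℝ} {q : Q}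
    (hS : LinearMap.range S.toEuclideanLin = P (b q)) : (designMatrix b P z * S).row q = 0 := by
  ext y
  have hmem : S.toEuclideanLin (EuclideanSpace.single y 1) ∈ P (b q) := hS ▸ ⟨_, rfl⟩
  have horth := Submodule.starProjection_inner_eq_zero (z q) _ hmem
  rw [EuclideanSpace.inner_eq_star_dotProduct, star_trivial, dotProduct_comm] at horth
  exact (congrArg _ (Matrix.mulVec_single_one S y).symm).trans horth

theorem rank_designMatrix_mul_add_le [Fintype Q] [DecidableEq ι] (b : Q → ι)
    (P : ι → Submodule ℝ (EuclideanSpace ℝ n)) (z : Q → EuclideanSpace ℝ n) {S : Matrix n n ℝ}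
    {i : ι} (hS : LinearMap.range S.toEuclideanLin = P i) :
    (designMatrix b P z * S).rank + (Finset.univ.filter (b · = i)).card ≤ Fintype.card Q := by
  classical
  have hrows : Set.range (designMatrix b P z * S).row ⊆
      insert 0 ((Finset.univ.filter (b · ≠ i)).image (designMatrix b P z * S).row :) := by
    rintro _ ⟨q, rfl⟩
    by_cases hq : b q = i
    · exact Or.inl (designMatrix_mul_row_eq_zero b P z (hq ▸ hS))
    · exact Or.inr (Finset.mem_coe.2 (Finset.mem_image_of_mem _
        (Finset.mem_filter.2 ⟨Finset.mem_univ q, hq⟩)))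
  have hrank : (designMatrix b P z * S).rank ≤ (Finset.univ.filter (b · ≠ i)).card := by
    rw [Matrix.rank_eq_finrank_span_row]
    refine (Submodule.finrank_mono (Submodule.span_mono hrows)).trans ?_
    rw [Submodule.span_insert_zero]
    exact (finrank_span_finset_le_card _).trans Finset.card_image_le
  have hcard := Finset.card_filter_add_card_filter_not (s := Finset.univ) fun q => b q = i
  rw [Finset.card_univ] at hcard
  linarith

end DesignMatrix

/-! ### Generic frames -/

section Frames

variable {n κ : Type*}

/-- The matrix whose columns are the vectors of the frame `a`. -/
def frameMatrix (a : κ → EuclideanSpace ℝ n) : Matrix n κ ℝ := Matrix.of fun x k => a k x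

/-- The frame of the coordinate vectors `e_{σ k}`. -/
noncomputable def coordinateFrame [DecidableEq n] (σ : κ → n) : κ → EuclideanSpace ℝ n :=
  fun k => EuclideanSpace.single (σ k) 1

variable [Fintype n]

theorem gram_eq_transpose_mul_frameMatrix (a : κ → EuclideanSpace ℝ n) :
    Matrix.gram ℝ a = (frameMatrix a)ᵀ * frameMatrix a := by
  ext k l
  simp [frameMatrix, Matrix.gram_apply, Matrix.mul_apply, PiLp.inner_apply, mul_comm]

theorem projMatrix_span_mul_frameMatrix [DecidableEq n] (a : κ → EuclideanSpace ℝ n) :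
    projMatrix (Submodule.span ℝ (Set.range a)) * frameMatrix a = frameMatrix a := by
  ext x k
  exact congrFun ((projMatrix_mulVec _ (a k)).trans (congrArg WithLp.ofLp
    (Submodule.starProjection_eq_self_iff.2 (Submodule.subset_span (Set.mem_range_self k))))) x

theorem gram_coordinateFrame [DecidableEq n] [DecidableEq κ] {σ : κ → n}
    (hσ : Function.Injective σ) : Matrix.gram ℝ (coordinateFrame σ) = 1 := by
  ext k l
  simp [coordinateFrame, Matrix.gram_apply, Matrix.one_apply, EuclideanSpace.inner_single_left,
    PiLp.single_apply, hσ.eq_iff]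

theorem exists_projMatrix_span_mulVec_eq [DecidableEq n] [Fintype κ]
    (a : κ → EuclideanSpace ℝ n) (x : EuclideanSpace ℝ n) :
    ∃ w : κ → ℝ, projMatrix (Submodule.span ℝ (Set.range a)) *ᵥ x.ofLp = frameMatrix a *ᵥ w := by
  obtain ⟨w, hw⟩ := (Submodule.mem_span_range_iff_exists_fun ℝ).1
    (Submodule.starProjection_apply_mem (Submodule.span ℝ (Set.range a)) x)
  refine ⟨w, ?_⟩
  rw [projMatrix_mulVec, ← hw]
  ext i
  simp [frameMatrix, Matrix.mulVec, dotProduct, mul_comm]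

variable [Fintype κ] [DecidableEq κ]

/-- The multiple of the projection onto the span of the frame `a` by its Gram determinant (see
`scaledProj_eq_smul`). Unlike the projection itself, it is a polynomial function of the frame. -/
noncomputable def scaledProj (a : κ → EuclideanSpace ℝ n) : Matrix n n ℝ :=
  frameMatrix a * (Matrix.gram ℝ a).adjugate * (frameMatrix a)ᵀ

theorem scaledProj_mul_frameMatrix (a : κ → EuclideanSpace ℝ n) :
    scaledProj a * frameMatrix a = (Matrix.gram ℝ a).det • frameMatrix a := by
  rw [scaledProj, Matrix.mul_assoc, Matrix.mul_assoc, ← gram_eq_transpose_mul_frameMatrix,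
    Matrix.adjugate_mul, Matrix.mul_smul, Matrix.mul_one]

variable [DecidableEq n]

theorem scaledProj_mul_projMatrix_span (a : κ → EuclideanSpace ℝ n) :
    scaledProj a * projMatrix (Submodule.span ℝ (Set.range a)) = scaledProj a := by
  have hsymm := (posSemidef_projMatrix (Submodule.span ℝ (Set.range a))).isHermitian.eq
  rw [Matrix.conjTranspose_eq_transpose_of_trivial] at hsymm
  rw [scaledProj, Matrix.mul_assoc, ← hsymm, ← Matrix.transpose_mul,
    projMatrix_span_mul_frameMatrix]

theorem scaledProj_eq_smul (a : κ → EuclideanSpace ℝ n) :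
    scaledProj a = (Matrix.gram ℝ a).det • projMatrix (Submodule.span ℝ (Set.range a)) := by
  refine Matrix.toLin'.injective (LinearMap.ext fun x => ?_)
  obtain ⟨w, hw⟩ := exists_projMatrix_span_mulVec_eq a (WithLp.toLp 2 x)
  calc scaledProj a *ᵥ x
      = scaledProj a *ᵥ frameMatrix a *ᵥ w := by
        rw [← hw, Matrix.mulVec_mulVec, scaledProj_mul_projMatrix_span]
    _ = (Matrix.gram ℝ a).det • frameMatrix a *ᵥ w := by
        rw [Matrix.mulVec_mulVec, scaledProj_mul_frameMatrix, Matrix.smul_mulVec]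
    _ = ((Matrix.gram ℝ a).det • projMatrix (Submodule.span ℝ (Set.range a))) *ᵥ x := by
        rw [← hw, Matrix.smul_mulVec]

theorem scaledProj_coordinateFrame {σ : κ → n} (hσ : Function.Injective σ) :
    scaledProj (coordinateFrame σ) =
      Matrix.diagonal fun x => if x ∈ Finset.univ.image σ then 1 else 0 := by
  rw [scaledProj, gram_coordinateFrame hσ, Matrix.adjugate_one, Matrix.mul_one]
  ext x y
  have hsum : (frameMatrix (coordinateFrame σ) * (frameMatrix (coordinateFrame σ))ᵀ) x y =
      ∑ u ∈ Finset.univ.image σ, if y = u then if x = u then (1 : ℝ) else 0 else 0 := by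
    rw [Finset.sum_image hσ.injOn]
    simp [Matrix.mul_apply, frameMatrix, coordinateFrame]
  rw [hsum, Finset.sum_ite_eq, Matrix.diagonal_apply]
  grind

end Frames

theorem exists_injective_image_eq {n κ : Type*} [DecidableEq n] [Fintype κ] {A : Finset n}
    (hA : A.card = Fintype.card κ) :
    ∃ σ : κ → n, Function.Injective σ ∧ Finset.univ.image σ = A := by
  let e : κ ≃ A := Fintype.equivOfCardEq (hA.symm.trans (Fintype.card_coe A).symm)
  refine ⟨fun k => e k, Subtype.val_injective.comp e.injective, Finset.ext fun x => ?_⟩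
  rw [Finset.mem_image]
  exact ⟨fun ⟨k, _, hk⟩ => hk ▸ (e k).2,
    fun hx => ⟨e.symm ⟨x, hx⟩, Finset.mem_univ _, by rw [e.apply_symm_apply]⟩⟩

section GenericityTest

variable {ι Q n κ τ : Type*} [Fintype n] [Fintype κ] [DecidableEq κ]

/-- The rows of `designMatrix`, for the spans of the frames `a`, scaled by the Gram determinants so
as to be polynomial functions of the frames. -/
noncomputable def scaledDesignMatrix (b : Q → ι) (a : ι → κ → EuclideanSpace ℝ n)
    (z : Q → EuclideanSpace ℝ n) : Matrix Q n ℝ :=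
  Matrix.of fun q =>
    (Matrix.gram ℝ (a (b q))).det • (z q).ofLp - scaledProj (a (b q)) *ᵥ (z q).ofLp

/-- A polynomial function of frames `a` and vectors `z` whose nonvanishing makes the design generic
for the pair of classes `i`, `j`: a minor of the scaled design matrix applied to the sum of the
scaled projections. -/
noncomputable def genericityTest [Fintype τ] [DecidableEq τ] (b : Q → ι) (i j : ι) (rows : τ → Q)
    (cols : τ → n) (a : ι → κ → EuclideanSpace ℝ n) (z : Q → EuclideanSpace ℝ n) : ℝ :=
  ((scaledDesignMatrix b a z * (scaledProj (a i) + scaledProj (a j))).submatrix rows cols).det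

theorem scaledDesignMatrix_eq_diagonal_mul [DecidableEq Q] [Fintype Q] (b : Q → ι)
    (a : ι → κ → EuclideanSpace ℝ n) (z : Q → EuclideanSpace ℝ n) :
    scaledDesignMatrix b a z = Matrix.diagonal (fun q => (Matrix.gram ℝ (a (b q))).det) *
      designMatrix b (fun l => Submodule.span ℝ (Set.range (a l))) z := by
  classical
  ext q x
  rw [Matrix.diagonal_mul, designMatrix_apply, scaledDesignMatrix, Matrix.of_apply,
    scaledProj_eq_smul, Matrix.smul_mulVec, ← smul_sub, Pi.smul_apply, smul_eq_mul]

theorem range_scaledProj_add_le [DecidableEq n] (a₁ a₂ : κ → EuclideanSpace ℝ n) :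
    LinearMap.range (scaledProj a₁ + scaledProj a₂).toEuclideanLin ≤
      LinearMap.range (projMatrix (Submodule.span ℝ (Set.range a₁)) +
        projMatrix (Submodule.span ℝ (Set.range a₂))).toEuclideanLin := by
  rw [range_toEuclideanLin_add (posSemidef_projMatrix _) (posSemidef_projMatrix _),
    scaledProj_eq_smul, scaledProj_eq_smul, map_add, map_smul, map_smul]
  refine (LinearMap.range_add_le _ _).trans (sup_le_sup ?_ ?_) <;>
  · rintro _ ⟨x, rfl⟩
    exact Submodule.smul_mem _ _ ⟨x, rfl⟩

theorem card_le_rank_of_det_submatrix_ne_zero {m : Type*} [Fintype τ] [DecidableEq τ]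
    {A : Matrix m n ℝ} {rows : τ → m} {cols : τ → n} (h : (A.submatrix rows cols).det ≠ 0) :
    Fintype.card τ ≤ A.rank :=
  (Matrix.rank_of_isUnit _ ((Matrix.isUnit_iff_isUnit_det _).2 h.isUnit)).symm.trans_le
    (Matrix.rank_submatrix_le _ _ _)

theorem card_le_rank_of_genericityTest_ne_zero [DecidableEq n] [Fintype τ] [DecidableEq τ]
    [Finite Q] {b : Q → ι} {i j : ι} {rows : τ → Q} {cols : τ → n}
    {a : ι → κ → EuclideanSpace ℝ n} {z : Q → EuclideanSpace ℝ n}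
    (h : genericityTest b i j rows cols a z ≠ 0) :
    Fintype.card τ ≤ (designMatrix b (fun l => Submodule.span ℝ (Set.range (a l))) z *
      (projMatrix (Submodule.span ℝ (Set.range (a i))) +
        projMatrix (Submodule.span ℝ (Set.range (a j))))).rank := by
  classical
  have := Fintype.ofFinite Q
  refine (card_le_rank_of_det_submatrix_ne_zero h).trans ?_
  rw [scaledDesignMatrix_eq_diagonal_mul, Matrix.mul_assoc]
  exact (Matrix.rank_mul_le_right _ _).trans
    (rank_mul_le_of_range_le _ (range_scaledProj_add_le _ _))

theorem scaledDesignMatrix_coordinateFrame_apply [DecidableEq n] {b : Q → ι} {σ : ι → κ → n}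
    (hσ : ∀ l, Function.Injective (σ l)) {z : Q → EuclideanSpace ℝ n} {q : Q} {x : n}
    (hz : z q = EuclideanSpace.single x 1) (hx : x ∉ Finset.univ.image (σ (b q))) (y : n) :
    scaledDesignMatrix b (fun l => coordinateFrame (σ l)) z q y = if y = x then 1 else 0 := by
  rw [scaledDesignMatrix, Matrix.of_apply, gram_coordinateFrame (hσ _), Matrix.det_one, one_smul,
    scaledProj_coordinateFrame (hσ _), hz, PiLp.ofLp_single,
    Matrix.diagonal_mulVec_single, if_neg hx, zero_mul, Pi.single_zero, sub_zero,
    Pi.single_apply]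

theorem exists_genericityTest_ne_zero [DecidableEq ι] [Fintype τ] [DecidableEq τ] (b : Q → ι)
    {rows : τ → Q} (hrows : Function.Injective rows) {i j : ι} (hij : i ≠ j)
    (hτ : Fintype.card τ ≤ min (Fintype.card n) (2 * Fintype.card κ))
    (hb : ∀ l, (Finset.univ.filter fun s => b (rows s) = l).card + Fintype.card κ ≤
      Fintype.card n)
    (hi : (Finset.univ.filter fun s => b (rows s) = i).card ≤ Fintype.card κ)
    (hj : (Finset.univ.filter fun s => b (rows s) = j).card ≤ Fintype.card κ) :
    ∃ (cols : τ → n) (a : ι → κ → EuclideanSpace ℝ n) (z : Q → EuclideanSpace ℝ n),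
      genericityTest b i j rows cols a z ≠ 0 := by
  classical
  obtain ⟨A, c, hA, hc, hcA, hcij⟩ :=
    exists_coordinate_design (fun s => b (rows s)) hij hτ hb hi hj
  choose σ hσ hσA using fun l => exists_injective_image_eq (hA l)
  refine ⟨c, fun l => coordinateFrame (σ l),
    Function.extend rows (fun s => EuclideanSpace.single (c s) 1) 0, ?_⟩
  set z : Q → EuclideanSpace ℝ n := Function.extend rows (fun s => EuclideanSpace.single (c s) 1) 0
  have hrow (s : τ) := scaledDesignMatrix_coordinateFrame_apply (z := z) hσ
    (hrows.extend_apply _ _ s) ((hσA (b (rows s))).symm ▸ hcA s)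
  have hdiag : (scaledDesignMatrix b (fun l => coordinateFrame (σ l)) z *
      (scaledProj (coordinateFrame (σ i)) + scaledProj (coordinateFrame (σ j)))).submatrix rows c =
      Matrix.diagonal fun s => (if c s ∈ A i then (1 : ℝ) else 0) + if c s ∈ A j then 1 else 0 := by
    ext s t
    rw [scaledProj_coordinateFrame (hσ i), scaledProj_coordinateFrame (hσ j), Matrix.diagonal_add,
      Matrix.submatrix_apply, Matrix.mul_diagonal, hrow, Matrix.diagonal_apply, hσA, hσA]
    simp only [hc.eq_iff]
    grind
  rw [genericityTest, hdiag, Matrix.det_diagonal]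
  refine Finset.prod_ne_zero_iff.2 fun s _ => ?_
  rcases Finset.mem_union.1 (hcij s) with h | h <;> rw [if_pos h] <;> split_ifs <;> norm_num

end GenericityTest

/-! ### Genericity of almost all frames -/

namespace PolynomialOnLines

variable {E n κ : Type*} [NormedAddCommGroup E] [NormedSpace ℝ E] [Fintype n]

theorem gram {a : E → κ → EuclideanSpace ℝ n} (ha : ∀ k x, PolynomialOnLines fun e => a e k x)
    (k l : κ) : PolynomialOnLines fun e => Matrix.gram ℝ (a e) k l := by
  simp only [gram_eq_transpose_mul_frameMatrix]
  exact matrix_mul (fun k x => ha k x) (fun x k => ha k x) k l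

variable [Fintype κ] [DecidableEq κ]

theorem scaledProj {a : E → κ → EuclideanSpace ℝ n}
    (ha : ∀ k x, PolynomialOnLines fun e => a e k x) (x y : n) :
    PolynomialOnLines fun e => scaledProj (a e) x y :=
  matrix_mul (matrix_mul (fun x k => ha k x) (adjugate (gram ha))) (fun k x => ha k x) x y

theorem scaledDesignMatrix {ι Q : Type*} {b : Q → ι} {a : E → ι → κ → EuclideanSpace ℝ n}
    {z : E → Q → EuclideanSpace ℝ n} (ha : ∀ l k x, PolynomialOnLines fun e => a e l k x)
    (hz : ∀ q x, PolynomialOnLines fun e => z e q x) (q : Q) (x : n) :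
    PolynomialOnLines fun e => scaledDesignMatrix b (a e) (z e) q x :=
  ((det (gram (ha (b q)))).mul (hz q x)).sub
    (sum _ fun y => (scaledProj (ha (b q)) x y).mul (hz q y))

theorem genericityTest {ι Q τ : Type*} [Fintype τ] [DecidableEq τ] {b : Q → ι} {i j : ι}
    {rows : τ → Q} {cols : τ → n} {a : E → ι → κ → EuclideanSpace ℝ n}
    {z : E → Q → EuclideanSpace ℝ n} (ha : ∀ l k x, PolynomialOnLines fun e => a e l k x)
    (hz : ∀ q x, PolynomialOnLines fun e => z e q x) :
    PolynomialOnLines fun e => genericityTest b i j rows cols (a e) (z e) :=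
  det fun s t => matrix_mul (scaledDesignMatrix ha hz)
    (fun x y => (scaledProj (ha i) x y).add (scaledProj (ha j) x y)) (rows s) (cols t)

end PolynomialOnLines

section GenericRank

variable {ι : Type*} [Fintype ι] [DecidableEq ι]

/-- The rank, for a generic design with `m l` rows blind to the class `l`, of the image of the sum
of the subspaces of the classes `i` and `j`, the classes having generic subspaces of dimension `r`
in dimension `N`. -/
def genericRank (N r : ℕ) (m : ι → ℕ) (i j : ι) : ℕ :=
  min (min N (2 * r)) (∑ l, min (m l) (if l = i ∨ l = j then min r (N - r) else N - r))

variable {Q : Type*} [Fintype Q] {N r : ℕ}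

theorem exists_genericityTest_ne_zero_of_genericRank [DecidableEq Q] (hr : r ≤ N)
    (b : Q → ι) {i j : ι} (hij : i ≠ j) :
    ∃ (T : Finset Q) (cols : T → Fin N) (a : ι → Fin r → EuclideanSpace ℝ (Fin N))
      (z : Q → EuclideanSpace ℝ (Fin N)),
      T.card = genericRank N r (fun l => (Finset.univ.filter (b · = l)).card) i j ∧
        genericityTest b i j (fun q : T => (q : Q)) cols a z ≠ 0 := by
  obtain ⟨T, hT, hTb⟩ := exists_finset_card_fiber_le b
    (fun l => if l = i ∨ l = j then min r (N - r) else N - r) (min_le_right (min N (2 * r)) _)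
  have hfiber (l : ι) : (Finset.univ.filter fun q : T => b q = l).card =
      (T.filter (b · = l)).card := by
    rw [Finset.univ_eq_attach, Finset.filter_attach (b · = l), Finset.card_map,
      Finset.card_attach]
  have hcap (l : ι) : (if l = i ∨ l = j then min r (N - r) else N - r) ≤ N - r := by
    split_ifs
    exacts [min_le_right _ _, le_rfl]
  obtain ⟨cols, a, z, h⟩ := exists_genericityTest_ne_zero (n := Fin N) (κ := Fin r) b
    (rows := fun q : T => (q : Q)) Subtype.val_injective hij (i := i) (j := j)
    (by simp only [Fintype.card_coe, Fintype.card_fin, hT]; exact min_le_left _ _)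
    (fun l => by
      rw [hfiber, Fintype.card_fin, Fintype.card_fin]
      exact (add_le_add_left ((hTb l).trans (hcap l)) r).trans_eq (Nat.sub_add_cancel hr))
    (by rw [hfiber, Fintype.card_fin]; exact (hTb i).trans (by simp))
    (by rw [hfiber, Fintype.card_fin]; exact (hTb j).trans (by simp))
  exact ⟨T, cols, a, z, hT, h⟩

theorem ae_genericRank_le_rank (hr : r ≤ N) (b : Q → ι) {i j : ι} (hij : i ≠ j) :
    ∀ᵐ e ∂(volume : Measure (ι → Fin r → EuclideanSpace ℝ (Fin N))).prod
        (volume : Measure (Q → EuclideanSpace ℝ (Fin N))),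
      genericRank N r (fun l => (Finset.univ.filter (b · = l)).card) i j ≤
        (designMatrix b (fun l => Submodule.span ℝ (Set.range (e.1 l))) e.2 *
          (projMatrix (Submodule.span ℝ (Set.range (e.1 i))) +
            projMatrix (Submodule.span ℝ (Set.range (e.1 j))))).rank := by
  have : (volume : Measure (Fin r → EuclideanSpace ℝ (Fin N))).IsAddHaarMeasure :=
    Measure.pi.isAddHaarMeasure _
  have : (volume : Measure (ι → Fin r → EuclideanSpace ℝ (Fin N))).IsAddHaarMeasure :=
    Measure.pi.isAddHaarMeasure _
  have : (volume : Measure (Q → EuclideanSpace ℝ (Fin N))).IsAddHaarMeasure :=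
    Measure.pi.isAddHaarMeasure _
  have : ((volume : Measure (ι → Fin r → EuclideanSpace ℝ (Fin N))).prod
      (volume : Measure (Q → EuclideanSpace ℝ (Fin N)))).IsAddHaarMeasure :=
    Measure.prod.instIsAddHaarMeasure _ _
  classical
  obtain ⟨T, cols, a, z, hT, h⟩ := exists_genericityTest_ne_zero_of_genericRank hr b hij
  have hpoly : PolynomialOnLines fun e : (ι → Fin r → EuclideanSpace ℝ (Fin N)) ×
      (Q → EuclideanSpace ℝ (Fin N)) => genericityTest b i j (fun q : T => (q : Q)) cols e.1 e.2 :=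
    .genericityTest
      (fun l k x => .of_continuousLinearMap ((EuclideanSpace.proj (𝕜 := ℝ) x) ∘L
        (.proj (R := ℝ) (φ := fun _ : Fin r => EuclideanSpace ℝ (Fin N)) k) ∘L
        (.proj (R := ℝ) (φ := fun _ : ι => Fin r → EuclideanSpace ℝ (Fin N)) l) ∘L
        .fst ℝ (ι → Fin r → EuclideanSpace ℝ (Fin N)) (Q → EuclideanSpace ℝ (Fin N))))
      (fun q x => .of_continuousLinearMap ((EuclideanSpace.proj (𝕜 := ℝ) x) ∘L
        (.proj (R := ℝ) (φ := fun _ : Q => EuclideanSpace ℝ (Fin N)) q) ∘L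
        .snd ℝ (ι → Fin r → EuclideanSpace ℝ (Fin N)) (Q → EuclideanSpace ℝ (Fin N))))
  filter_upwards [hpoly.ae_ne_zero (Measure.prod volume volume) (x₀ := (a, z)) h] with e he
  rw [← hT, ← Fintype.card_coe]
  exact card_le_rank_of_genericityTest_ne_zero he

end GenericRank

/-! ### Generic subspaces -/

theorem pi_fin_absolutelyContinuous : ∀ {n : ℕ} {α : Fin n → Type*} [∀ i, MeasurableSpace (α i)]
    {μ ν : ∀ i, Measure (α i)} [∀ i, SigmaFinite (μ i)] [∀ i, SigmaFinite (ν i)],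
    (∀ i, μ i ≪ ν i) → Measure.pi μ ≪ Measure.pi ν
  | 0, _, _, μ, ν, _, _, _ => by
    rw [Measure.pi_of_empty μ fun i => i.elim0, Measure.pi_of_empty ν fun i => i.elim0]
  | _ + 1, _, _, μ, ν, _, _, h => by
    have hμ := (measurePreserving_piFinSuccAbove μ 0).symm
    have hν := (measurePreserving_piFinSuccAbove ν 0).symm
    rw [← hμ.map_eq, ← hν.map_eq]
    exact ((h 0).prod (pi_fin_absolutelyContinuous fun j => h (Fin.succAbove 0 j))).map
      hμ.measurable

theorem pi_absolutelyContinuous {ι : Type*} [Fintype ι] {α : ι → Type*}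
    [∀ i, MeasurableSpace (α i)] {μ ν : ∀ i, Measure (α i)} [∀ i, SigmaFinite (μ i)]
    [∀ i, SigmaFinite (ν i)] (h : ∀ i, μ i ≪ ν i) : Measure.pi μ ≪ Measure.pi ν := by
  have hμ := measurePreserving_piCongrLeft μ (Fintype.equivFin ι).symm
  have hν := measurePreserving_piCongrLeft ν (Fintype.equivFin ι).symm
  rw [← hμ.map_eq, ← hν.map_eq]
  exact (pi_fin_absolutelyContinuous fun j => h _).map hμ.measurable

theorem isOpen_setOf_le_rank {m n : Type*} [Finite m] [Fintype n] (k : ℕ) :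
    IsOpen {X : m → n → ℝ | k ≤ (Matrix.of X).rank} := by
  classical
  have := Fintype.ofFinite m
  have hcont : Continuous fun X : m → n → ℝ =>
      LinearMap.toContinuousLinearMap (Matrix.of X).mulVecLin :=
    LinearMap.continuous_of_finiteDimensional (LinearMap.toContinuousLinearMap.toLinearMap ∘ₗ
      Matrix.toLin'.toLinearMap ∘ₗ (Matrix.ofLinearEquiv ℝ).toLinearMap)
  convert (isOpen_setOfPred_nat_le_rank (𝕜 := ℝ) (E := n → ℝ) (F := m → ℝ) k).preimage hcont using 1
  ext X
  simp only [Set.mem_preimage, Set.mem_ofPred_eq, LinearMap.coe_toContinuousLinearMap,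
    LinearMap.rank, Matrix.rank, ← Module.finrank_eq_rank, Nat.cast_le]
  rfl

section Measurability

variable {N r : ℕ}

theorem measurable_projMatrix_apply (x y : Fin N) :
    Measurable fun V : Grassmannian N r => projMatrix V.1 x y := by
  have hproj (V : Grassmannian N r) : projMatrix V.1 x y = V.proj x y := by
    have h := congrFun (projMatrix_mulVec V.1 (EuclideanSpace.single y 1)) x
    rwa [PiLp.ofLp_single, Matrix.mulVec_single_one] at h
  simp only [hproj]
  exact (measurable_pi_apply y).comp
    ((measurable_pi_apply x).comp (comap_measurable Grassmannian.proj))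

theorem measurableSet_le_rank_designMatrix_mul {ι Q : Type*} [Finite Q] (b : Q → ι) (i j : ι)
    (k : ℕ) :
    MeasurableSet {e : (ι → Grassmannian N r) × (Q → EuclideanSpace ℝ (Fin N)) |
      k ≤ (designMatrix b (fun l => (e.1 l).1) e.2 *
        (projMatrix (e.1 i).1 + projMatrix (e.1 j).1)).rank} := by
  have hP (l : ι) (x y : Fin N) : Measurable fun e : (ι → Grassmannian N r) ×
      (Q → EuclideanSpace ℝ (Fin N)) => projMatrix (e.1 l).1 x y :=
    (measurable_projMatrix_apply x y).comp ((measurable_pi_apply l).comp measurable_fst)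
  have hz (q : Q) (x : Fin N) : Measurable fun e : (ι → Grassmannian N r) ×
      (Q → EuclideanSpace ℝ (Fin N)) => e.2 q x :=
    (EuclideanSpace.proj (𝕜 := ℝ) x).continuous.measurable.comp
      ((measurable_pi_apply q).comp measurable_snd)
  have hmeas : Measurable fun (e : (ι → Grassmannian N r) × (Q → EuclideanSpace ℝ (Fin N))) q x =>
      (designMatrix b (fun l => (e.1 l).1) e.2 *
        (projMatrix (e.1 i).1 + projMatrix (e.1 j).1)) q x := by
    refine measurable_pi_lambda _ fun q => measurable_pi_lambda _ fun x => ?_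
    simp only [Matrix.mul_apply, designMatrix_apply, Pi.sub_apply, Matrix.mulVec, dotProduct,
      Matrix.add_apply]
    exact Finset.measurable_fun_sum _ fun y _ => ((hz q y).sub
      (Finset.measurable_fun_sum _ fun w _ => (hP (b q) y w).mul (hz q w))).mul
        ((hP i y x).add (hP j y x))
  exact hmeas (isOpen_setOf_le_rank k).measurableSet

end Measurability

section UniformGrassmann

variable {ι : Type*} [Fintype ι] {N r : ℕ}

/-- The law of a standard Gaussian frame, restricted to the linearly independent frames. -/
noncomputable def gaussianFrame (N r : ℕ) :
    Measure {a : Fin r → EuclideanSpace ℝ (Fin N) // LinearIndependent ℝ a} :=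
  (Measure.pi fun _ : Fin r => stdGaussian (EuclideanSpace ℝ (Fin N))).comap Subtype.val

theorem measurableEmbedding_val_linearIndependent (N r : ℕ) : MeasurableEmbedding
    (Subtype.val : {a : Fin r → EuclideanSpace ℝ (Fin N) // LinearIndependent ℝ a} → _) :=
  .subtype_coe isOpen_setOfPred_linearIndependent.measurableSet

instance : IsFiniteMeasure (gaussianFrame N r) :=
  inferInstanceAs (IsFiniteMeasure (Measure.comap _ _))

instance : IsFiniteMeasure (uniformGrassmann N r) :=
  inferInstanceAs (IsFiniteMeasure ((gaussianFrame N r).map (frameSpan N r)))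

theorem map_val_gaussianFrame_absolutelyContinuous (N r : ℕ) :
    (gaussianFrame N r).map Subtype.val ≪ volume := by
  rw [gaussianFrame, (measurableEmbedding_val_linearIndependent N r).map_comap]
  exact Measure.restrict_le_self.absolutelyContinuous.trans
    (pi_absolutelyContinuous fun _ => stdGaussian_absolutelyContinuous N)

theorem pi_uniformGrassmann (ι : Type*) [Fintype ι] (N r : ℕ) :
    (Measure.pi fun _ : ι => uniformGrassmann N r) =
    (Measure.pi fun _ => gaussianFrame N r).map fun a l => frameSpan N r (a l) :=
  (Measure.pi_map_pi (hμ := fun _ => inferInstanceAs (SigmaFinite (uniformGrassmann N r)))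
    fun _ => (measurable_frameSpan N r).aemeasurable).symm

theorem ae_pi_uniformGrassmann_of_ae_frames {G : Set (ι → Grassmannian N r)}
    (hG : MeasurableSet G) {s : Set (ι → Fin r → EuclideanSpace ℝ (Fin N))}
    (hs : ∀ᵐ a, a ∈ s)
    (h : ∀ a : ι → {a : Fin r → EuclideanSpace ℝ (Fin N) // LinearIndependent ℝ a},
      (fun l => (a l).1) ∈ s → (fun l => frameSpan N r (a l)) ∈ G) :
    ∀ᵐ P ∂Measure.pi fun _ : ι => uniformGrassmann N r, P ∈ G := by
  have hval : Measurable fun (a : ι → {a : Fin r → EuclideanSpace ℝ (Fin N) //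
      LinearIndependent ℝ a}) l => (a l).1 :=
    measurable_pi_lambda _ fun l => measurable_subtype_coe.comp (measurable_pi_apply l)
  have hac : (Measure.pi fun _ : ι => gaussianFrame N r).map (fun a l => (a l).1) ≪ volume := by
    rw [Measure.pi_map_pi fun _ => measurable_subtype_coe.aemeasurable]
    exact pi_absolutelyContinuous fun _ => map_val_gaussianFrame_absolutelyContinuous N r
  have hspan : Measurable fun (a : ι → {a : Fin r → EuclideanSpace ℝ (Fin N) //
      LinearIndependent ℝ a}) l => frameSpan N r (a l) :=
    measurable_pi_lambda _ fun l => (measurable_frameSpan N r).comp (measurable_pi_apply l)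
  rw [pi_uniformGrassmann]
  refine (ae_map_iff hspan.aemeasurable hG).2 ?_
  filter_upwards [ae_of_ae_map hval.aemeasurable (hac.ae_le hs)] with a ha using h a ha

theorem ae_exists_genericRank_le_rank [DecidableEq ι] {Q : Type*} [Fintype Q] (hr : r ≤ N)
    (b : Q → ι) :
    ∀ᵐ P ∂Measure.pi fun _ : ι => uniformGrassmann N r,
      ∃ z : Q → EuclideanSpace ℝ (Fin N), ∀ i j, i ≠ j →
        genericRank N r (fun l => (Finset.univ.filter (b · = l)).card) i j ≤
          (designMatrix b (fun l => (P l).1) z *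
            (projMatrix (P i).1 + projMatrix (P j).1)).rank := by
  set Good : Set ((ι → Grassmannian N r) × (Q → EuclideanSpace ℝ (Fin N))) :=
    {e | ∀ i j, i ≠ j → genericRank N r (fun l => (Finset.univ.filter (b · = l)).card) i j ≤
      (designMatrix b (fun l => (e.1 l).1) e.2 *
        (projMatrix (e.1 i).1 + projMatrix (e.1 j).1)).rank} with hGood
  have hmeas : MeasurableSet Good := by
    simp only [hGood, Set.ofPred_forall]
    exact .iInter fun i => .iInter fun j => .iInter fun _ =>
      measurableSet_le_rank_designMatrix_mul b i j _
  have hframes := Measure.ae_ae_of_ae_prod (ae_all_iff.2 fun i => ae_all_iff.2 fun j =>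
    ae_all_iff.2 fun hij : i ≠ j => ae_genericRank_le_rank hr b hij)
  have hae : ∀ᵐ P ∂Measure.pi fun _ : ι => uniformGrassmann N r, ∀ᵐ z, (P, z) ∈ Good :=
    ae_pi_uniformGrassmann_of_ae_frames
      (measurable_measure_prodMk_left hmeas.compl (measurableSet_singleton 0)) hframes
      fun _ ha => ha
  exact hae.mono fun P hP => hP.exists

end UniformGrassmann

/-! ### The integer program -/

section Program

variable {L N r : ℕ} {d₀ : ℝ} {m : Fin L → ℕ} {i j : Fin L}

theorem isFeasible_const (hr : r ≤ N) (hd₀ : d₀ < (2 * min (N - r) r : ℕ) / 4) :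
    IsFeasible L N r d₀ fun _ => N - r := by
  refine ⟨fun _ => (Nat.cast_sub hr).le, fun i j _ => ?_⟩
  have hd₀' : 4 * d₀ < ((2 * min (N - r) r : ℕ) : ℝ) := by linarith
  have hlt (t : ℤ) (ht : ((2 * min (N - r) r : ℕ) : ℤ) ≤ t) : (t : ℝ) > 4 * d₀ :=
    hd₀'.trans_le (by exact_mod_cast ht)
  refine ⟨hlt _ ?_, hlt _ ?_, hlt _ ?_, hlt _ ?_⟩ <;> unfold programF <;> beta_reduce <;> omega

theorem sum_min_ite_add_add (hm : ∀ l, m l + r ≤ N) (hij : i ≠ j) :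
    (∑ l, min (m l) (if l = i ∨ l = j then min r (N - r) else N - r)) + m i + m j =
      (∑ l, m l) + min (m i) r + min (m j) r := by
  have hterm (l : Fin L) : min (m l) (if l = i ∨ l = j then min r (N - r) else N - r) +
      (if l = i then m l else 0) + (if l = j then m l else 0) =
      m l + (if l = i then min (m l) r else 0) + if l = j then min (m l) r else 0 := by
    have := hm l
    grind
  simpa only [Finset.sum_add_distrib, Finset.sum_ite_eq', Finset.mem_univ, if_true] using
    Finset.sum_congr rfl fun l (_ : l ∈ Finset.univ) => hterm l

theorem genericRank_eq (hm : ∀ l, m l + r ≤ N) (hij : i ≠ j) :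
    genericRank N r m i j = min (min N (2 * r))
      (min (∑ l, m l) (min (∑ l, m l + r - m i) (∑ l, m l + r - m j))) := by
  have hsum := sum_min_ite_add_add hm hij
  have hpair : m i + m j ≤ ∑ l, m l :=
    (Finset.sum_pair hij).symm.trans_le (Finset.sum_le_univ_sum_of_nonneg fun _ => Nat.zero_le _)
  unfold genericRank
  omega

theorem lt_of_isFeasible (hd₀ : d₀ < (2 * min (N - r) r : ℕ) / 4)
    (hm : IsFeasible L N r d₀ m) (hij : i ≠ j) {a b c : ℕ} (ha : a ≤ r) (hb : b ≤ r)
    (ha' : a + m i ≤ ∑ l, m l) (hb' : b + m j ≤ ∑ l, m l) (hc : genericRank N r m i j ≤ c) :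
    d₀ < ((c : ℝ) - min (a : ℝ) b) / 2 := by
  obtain ⟨h2r, hi, hj, hsum⟩ := hm.2 i j hij
  suffices h : 4 * d₀ < ((2 * c - a - b : ℤ) : ℝ) by
    push_cast at h
    linarith [min_le_left (a : ℝ) b, min_le_right (a : ℝ) b]
  have hlt (t : ℤ) (ht : (t : ℝ) > 4 * d₀) (hle : t ≤ 2 * c - a - b) :
      4 * d₀ < ((2 * c - a - b : ℤ) : ℝ) := ht.lt.trans_le (by exact_mod_cast hle)
  have hN : (((2 * min (N - r) r : ℕ) : ℤ) : ℝ) > 4 * d₀ := by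
    rw [Int.cast_natCast]
    linarith
  have hcases : N ≤ c ∨ 2 * r ≤ c ∨ ∑ l, m l ≤ c ∨ ∑ l, m l + r - m i ≤ c ∨
      ∑ l, m l + r - m j ≤ c := by
    rw [genericRank_eq (fun l => by have := hm.1 l; omega) hij] at hc
    omega
  have hir := hm.1 i
  unfold programF at h2r hi hj hsum
  rcases hcases with h | h | h | h | h
  · exact hlt _ hN (by omega)
  · exact hlt _ h2r (by omega)
  · exact hlt _ hsum (by omega)
  · exact hlt _ hi (by omega)
  · exact hlt _ hj (by omega)

theorem exists_isLeast_programValues (hr : r ≤ N) (hd₀ : d₀ < (2 * min (N - r) r : ℕ) / 4)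
    (L : ℕ) : ∃ M, IsLeast (programValues L N r d₀) M :=
  ⟨_, Nat.sInf_mem ⟨_, _, isFeasible_const hr hd₀, rfl⟩, fun _ => Nat.sInf_le⟩

end Program

/-! ### Designs from the integer program -/

section Design

variable {L N r : ℕ} {m : Fin L → ℕ}

/-- The assignment of `m l` of the `∑ l, m l` rows of the design to each class `l`. -/
def rowClass (m : Fin L → ℕ) (q : Fin (∑ l, m l)) : Fin L := (finSigmaFinEquiv.symm q).1

theorem card_filter_rowClass (m : Fin L → ℕ) (l : Fin L) :
    (Finset.univ.filter (rowClass m · = l)).card = m l := by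
  calc (Finset.univ.filter (rowClass m · = l)).card
      = ∑ q, if (finSigmaFinEquiv.symm q).1 = l then 1 else 0 := Finset.card_filter _ _
    _ = ∑ s : (k : Fin L) × Fin (m k), if s.1 = l then 1 else 0 :=
      Equiv.sum_comp finSigmaFinEquiv.symm fun s => if s.1 = l then 1 else 0
    _ = ∑ k, ∑ _ : Fin (m k), if k = l then 1 else 0 := Fintype.sum_sigma _
    _ = m l := by simp

theorem decayExponentGT_designMatrix {p : Fin L → ℝ} (hp : ∀ i, 0 ≤ p i) {d₀ : ℝ}
    (hd₀ : d₀ < (2 * min (N - r) r : ℕ) / 4) (hm : IsFeasible L N r d₀ m)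
    {P : Fin L → Grassmannian N r} {z : Fin (∑ l, m l) → EuclideanSpace ℝ (Fin N)}
    (hz : ∀ i j, i ≠ j → genericRank N r m i j ≤ (designMatrix (rowClass m) (fun l => (P l).1) z *
      (projMatrix (P i).1 + projMatrix (P j).1)).rank)
    {S : Fin L → Matrix (Fin N) (Fin N) ℝ} (hS : ∀ i, (S i).PosSemidef)
    (hSP : ∀ i, LinearMap.range (S i).toEuclideanLin = (P i).1) :
    DecayExponentGT p S (designMatrix (rowClass m) (fun l => (P l).1) z) d₀ := by
  set Φ := designMatrix (rowClass m) (fun l => (P l).1) z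
  have hle (i : Fin L) : (Φ * S i * Φᵀ).rank ≤ r := by
    rw [rank_mul_mul_transpose Φ (hS i)]
    refine (Matrix.rank_mul_le_right _ _).trans ?_
    rw [rank_eq_finrank_range_toEuclideanLin, hSP i, (P i).2]
  have hadd (i : Fin L) : (Φ * S i * Φᵀ).rank + m i ≤ ∑ l, m l := by
    rw [rank_mul_mul_transpose Φ (hS i)]
    have h := rank_designMatrix_mul_add_le (rowClass m) (fun l => (P l).1) z (hSP i)
    rwa [card_filter_rowClass, Fintype.card_fin] at h
  refine decayExponentGT_of_lt_pairExponent hp hS fun i j hij =>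
    lt_of_isFeasible hd₀ hm hij (hle i) (hle j) (hadd i) (hadd j) ((hz i j hij).trans ?_)
  rw [← Matrix.add_mul, ← Matrix.mul_add, rank_mul_mul_transpose Φ ((hS i).add (hS j))]
  refine rank_mul_le_of_range_le _ ?_
  rw [range_toEuclideanLin_add (posSemidef_projMatrix _) (posSemidef_projMatrix _),
    range_toEuclideanLin_add (hS i) (hS j), range_projMatrix, range_projMatrix, hSP, hSP]

end Design

theorem map_absolutelyContinuous_pi {Ω ι : Type*} [MeasurableSpace Ω] [Fintype ι] {μ : Measure Ω}
    [IsProbabilityMeasure μ] {E : ι → Type*} [∀ i, MeasurableSpace (E i)] {R : ∀ i, Ω → E i}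
    (hR : ∀ i, Measurable (R i)) (hR_indep : iIndepFun R μ) {ν : ∀ i, Measure (E i)}
    [∀ i, SigmaFinite (ν i)] (hν : ∀ i, μ.map (R i) ≪ ν i) :
    μ.map (fun ω i => R i ω) ≪ Measure.pi ν := by
  rw [(iIndepFun_iff_map_fun_eq_pi_map fun i => (hR i).aemeasurable).1 hR_indep]
  exact pi_absolutelyContinuous hν

end LinearClassification

theorem proposition6_general (L N r : ℕ) (hr : r ≤ N) (p : Fin L → ℝ) (hp : ∀ i, 0 ≤ p i)
    (d₀ : ℝ) (hd₀ : d₀ < (2 * min (N - r) r : ℕ) / 4) :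
    ∀ᵐ P ∂Measure.pi fun _ : Fin L => uniformGrassmann N r,
      ∀ S : Fin L → Matrix (Fin N) (Fin N) ℝ, (∀ i, (S i).PosSemidef) →
        (∀ i, LinearMap.range (S i).toEuclideanLin = (P i).1) →
        ∃ Mopt : ℕ, IsLeast (programValues L N r d₀) Mopt ∧
          ∃ Mmin : ℕ,
            IsLeast {M : ℕ | ∃ Φ : Matrix (Fin M) (Fin N) ℝ, DecayExponentGT p S Φ d₀} Mmin ∧
            Mmin ≤ Mopt := by
  obtain ⟨_, hopt⟩ := exists_isLeast_programValues hr hd₀ L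
  obtain ⟨m, hm, rfl⟩ := hopt.1
  filter_upwards [ae_exists_genericRank_le_rank hr (rowClass m)] with P ⟨z, hz⟩ S hS hSP
  simp only [card_filter_rowClass] at hz
  have hmem : ∑ l, m l ∈ {M : ℕ | ∃ Φ : Matrix (Fin M) (Fin N) ℝ, DecayExponentGT p S Φ d₀} :=
    ⟨_, decayExponentGT_designMatrix hp hd₀ hm hz hS hSP⟩
  exact ⟨_, hopt, _, ⟨Nat.sInf_mem ⟨_, hmem⟩, fun _ => Nat.sInf_le⟩, Nat.sInf_le hmem⟩

theorem proposition6
    {Ω : Type*} [MeasurableSpace Ω] (μ : Measure Ω) [IsProbabilityMeasure μ]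
    (L N r : ℕ) (hr : r < N)
    (p : Fin L → ℝ) (hp : ∀ i, 0 ≤ p i) (hp_sum : ∑ i, p i = 1)
    (R : Fin L → Ω → Grassmannian N r) (hR : ∀ i, Measurable (R i))
    (hR_indep : iIndepFun R μ) (hR_law : ∀ i, μ.map (R i) ≪ uniformGrassmann N r)
    (d₀ : ℝ) (hd₀ : d₀ < (2 * min (N - r) r : ℕ) / 4) :
    ∀ᵐ ω ∂μ, ∀ S : Fin L → Matrix (Fin N) (Fin N) ℝ,
      (∀ i, (S i).PosSemidef) →
      (∀ i, LinearMap.range (S i).toEuclideanLin = (R i ω).1) →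
      ∃ Mopt : ℕ, IsLeast (programValues L N r d₀) Mopt ∧
        ∃ Mmin : ℕ,
          IsLeast {M : ℕ | ∃ Φ : Matrix (Fin M) (Fin N) ℝ, DecayExponentGT p S Φ d₀} Mmin ∧
          Mmin ≤ Mopt :=
  ae_of_ae_map (measurable_pi_lambda _ hR).aemeasurable
    ((map_absolutelyContinuous_pi hR hR_indep hR_law).ae_le
      (proposition6_general L N r hr.le p hp d₀ hd₀))
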